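/- Let $n\ge 1$ and let $M$ be a $(2n+1)$-dimensional connected smooth manifold with a Sasakian structure $(\varphi,\xi,\eta,g)$, that is: $\varphi$ is a smooth $(1,1)$-tensor field, $\xi$ a smooth vector field, $\eta$ a smooth 1-form and $g$ a Riemannian metric with $\varphi^2X=-X+\eta(X)\xi$, $\eta(\xi)=1$, $\varphi\xi=0$, $\eta\circ\varphi=0$, $g(\varphi X,\varphi Y)=g(X,Y)-\eta(X)\eta(Y)$, $d\eta(X,Y)=g(X,\varphi Y)$ and $[\varphi,\varphi]+2\,d\eta\otimes\xi=0$, where $2\,d\eta(X,Y)=X\eta(Y)-Y\eta(X)-\eta([X,Y])$ and $[\varphi,\varphi]$ is the Nijenhuis tensor of $\varphi$. Let $\nabla$ be the Levi-Civita connection, $R(X,Y)Z=\nabla_X\nabla_YZ-\nabla_Y\nabla_XZ-\nabla_{[X,Y]}Z$, $Ric$ the Ricci tensor, $Q$ the Ricci operator, $r$ the scalar curvature, let $$C(X,Y)Z=R(X,Y)Z-\tfrac{1}{2n-1}\{Ric(Y,Z)X-Ric(X,Z)Y+g(Y,Z)QX-g(X,Z)QY\}+\tfrac{r}{2n(2n-1)}\{g(Y,Z)X-g(X,Z)Y\}$$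 be the Weyl conformal curvature tensor, and let $Ric^*(X,Y)=\sum_{i=1}^{2n+1}g(R(X,e_i)\varphi e_i,\varphi Y)$ for an orthonormal basis $(e_i)$ of the tangent space, $Ric^\varphi(X,Y)=\frac12\{Ric^*(X,Y)+Ric^*(Y,X)\}$ and $g^\varphi(X,Y)=g(\varphi X,\varphi Y)$. (i) If $C=0$, then $$Ric^*(X,Y)=\frac{r-4n}{2n(2n-1)}\,g^\varphi(X,Y)$$ for all tangent vectors $X,Y$. (ii) If $M$ is conformally flat, that is, $C=0$ and, in the case $n=1$ (where $C=0$ holds for every metric), also the Cotton tensor $(\nabla_XP)(Y,Z)-(\nabla_YP)(X,Z)$ vanishes, where $P=\frac{1}{2n-1}\left(Ric-\frac{r}{4n}g\right)$ is the Schouten tensor, then $M$ is $\varphi$-Einstein: there is a constant $\beta$ with $Ric^\varphi=\beta\,g^\varphi$. -/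

import Mathlib

open Bundle
open scoped Manifold ContDiff

namespace SasakianGeometry

section Riemannian

variable {E : Type*} [NormedAddCommGroup E] [NormedSpace ℝ E] [FiniteDimensional ℝ E]
  {H : Type*} [TopologicalSpace H] {I : ModelWithCorners ℝ E H}
  {M : Type*} [TopologicalSpace M] [ChartedSpace H M] [IsManifold I ∞ M]
  [RiemannianBundle (fun x : M ↦ TangentSpace I x)]
  [IsContMDiffRiemannianBundle I ∞ E (fun x : M ↦ TangentSpace I x)]

/-! ### The Levi-Civita connection -/

variable (I) in
/-- The Koszul expression
`X⟨Y,Z⟩ + Y⟨X,Z⟩ - Z⟨X,Y⟩ + ⟨[X,Y],Z⟩ - ⟨[X,Z],Y⟩ - ⟨[Y,Z],X⟩`, that is, `2⟨∇_X Y, Z⟩`. -/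
noncomputable def koszul (X Y Z : Π x : M, TangentSpace I x) (x : M) : ℝ :=
  mvfderiv I (fun y ↦ inner ℝ (Y y) (Z y)) x (X x)
    + mvfderiv I (fun y ↦ inner ℝ (X y) (Z y)) x (Y x)
    - mvfderiv I (fun y ↦ inner ℝ (X y) (Y y)) x (Z x)
    + inner ℝ (VectorField.mlieBracket I X Y x) (Z x)
    - inner ℝ (VectorField.mlieBracket I X Z x) (Y x)
    - inner ℝ (VectorField.mlieBracket I Y Z x) (X x)

instance finiteDimensional_tangentSpace (x : M) : FiniteDimensional ℝ (TangentSpace I x) :=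
  inferInstanceAs (FiniteDimensional ℝ E)

set_option linter.unusedSectionVars false in
theorem mdiff_inner {X Z : Π x : M, TangentSpace I x} {x : M}
    (hX : MDiffAt (T% X) x) (hZ : MDiffAt (T% Z) x) :
    MDiffAt (fun y ↦ (inner ℝ (X y) (Z y) : ℝ)) x :=
  MDifferentiableAt.inner_bundle (E := fun x : M ↦ TangentSpace I x) (b := fun y ↦ y) hX hZ

theorem koszul_tensorial_left {Y Z : Π x : M, TangentSpace I x} {x : M}
    (hY : MDiffAt (T% Y) x) (hZ : MDiffAt (T% Z) x) :
    TensorialAt I E (fun X ↦ koszul I X Y Z x) x where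
  smul {f X} hf hX := by
    have e1 := mvfderiv_fun_mul hf (mdiff_inner hX hZ)
    have e2 := mvfderiv_fun_mul hf (mdiff_inner hX hY)
    simp [koszul, inner_smul_left, e1, e2, VectorField.mlieBracket_smul_left hf hX, inner_add_left, inner_smul_right]
    ring
  add {X X'} hX hX' := by
    have e1 := mvfderiv_fun_add (mdiff_inner hX hZ) (mdiff_inner hX' hZ)
    have e2 := mvfderiv_fun_add (mdiff_inner hX hY) (mdiff_inner hX' hY)
    simp [koszul, e1, e2, VectorField.mlieBracket_add_left hX hX', inner_add_left, inner_add_right]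
    ring

theorem koszul_tensorial_right {X Y : Π x : M, TangentSpace I x} {x : M}
    (hX : MDiffAt (T% X) x) (hY : MDiffAt (T% Y) x) :
    TensorialAt I E (fun Z ↦ koszul I X Y Z x) x where
  smul {f Z} hf hZ := by
    have e1 := mvfderiv_fun_mul hf (mdiff_inner hX hZ)
    have e2 := mvfderiv_fun_mul hf (mdiff_inner hY hZ)
    simp [koszul, inner_smul_left, e1, e2, VectorField.mlieBracket_smul_right hf hZ,
      inner_add_left, inner_smul_right]
    rw [real_inner_comm (X x) (Z x), real_inner_comm (Y x) (Z x)]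
    ring
  add {Z Z'} hZ hZ' := by
    have e1 := mvfderiv_fun_add (mdiff_inner hX hZ) (mdiff_inner hX hZ')
    have e2 := mvfderiv_fun_add (mdiff_inner hY hZ) (mdiff_inner hY hZ')
    simp [koszul, e1, e2, VectorField.mlieBracket_add_right hZ hZ', inner_add_left, inner_add_right]
    ring

theorem koszul_add_mid {X Y Y' Z : Π x : M, TangentSpace I x} {x : M}
    (hX : MDiffAt (T% X) x) (hY : MDiffAt (T% Y) x) (hY' : MDiffAt (T% Y') x)
    (hZ : MDiffAt (T% Z) x) :
    koszul I X (Y + Y') Z x = koszul I X Y Z x + koszul I X Y' Z x := by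
  have e1 := mvfderiv_fun_add (mdiff_inner hX hY) (mdiff_inner hX hY')
  have e2 := mvfderiv_fun_add (mdiff_inner hY hZ) (mdiff_inner hY' hZ)
  simp [koszul, e1, e2, VectorField.mlieBracket_add_right hY hY',
    VectorField.mlieBracket_add_left hY hY', inner_add_left, inner_add_right]
  ring

theorem koszul_smul_mid {X Y Z : Π x : M, TangentSpace I x} {f : M → ℝ} {x : M}
    (hf : MDiffAt f x)
    (hX : MDiffAt (T% X) x) (hY : MDiffAt (T% Y) x) (hZ : MDiffAt (T% Z) x) :
    koszul I X (f • Y) Z x = f x * koszul I X Y Z x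
      + 2 * mvfderiv I f x (X x) * inner ℝ (Y x) (Z x) := by
  have e1 := mvfderiv_fun_mul hf (mdiff_inner hX hY)
  have e2 := mvfderiv_fun_mul hf (mdiff_inner hY hZ)
  simp [koszul, inner_smul_left, e1, e2, VectorField.mlieBracket_smul_right hf hY,
    VectorField.mlieBracket_smul_left hf hY, inner_add_left, inner_smul_right]
  rw [real_inner_comm (Y x) (X x)]
  ring

open Classical in
variable (I) in
/-- `leviCivitaFun I Y x u` is `∇_u Y` at `x`: the tangent vector with
`2⟨∇_u Y, Z x⟩ = koszul I X Y Z x` whenever `X x = u`. It is `0` by convention at points where `Y`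
is not differentiable. -/
noncomputable def leviCivitaFun (Y : Π x : M, TangentSpace I x) (x : M) :
    TangentSpace I x →L[ℝ] TangentSpace I x :=
  if hY : MDiffAt (T% Y) x then
    ∑ i, ((1 / 2 : ℝ) • TensorialAt.mkHom (fun X ↦
        koszul I X Y (FiberBundle.extend E (stdOrthonormalBasis ℝ (TangentSpace I x) i)) x) x
        (koszul_tensorial_left hY (FiberBundle.mdifferentiableAt_extend ..))).smulRight
      (stdOrthonormalBasis ℝ (TangentSpace I x) i)
  else 0

theorem inner_leviCivitaFun {X Y Z : Π x : M, TangentSpace I x} {x : M}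
    (hX : MDiffAt (T% X) x) (hY : MDiffAt (T% Y) x) (hZ : MDiffAt (T% Z) x) :
    inner ℝ (leviCivitaFun I Y x (X x)) (Z x) = 1 / 2 * koszul I X Y Z x := by
  have hZe : ∀ v : TangentSpace I x, koszul I X Y (FiberBundle.extend E v) x
      = TensorialAt.mkHom _ x (koszul_tensorial_right hX hY) v := fun v ↦ rfl
  have hb := (stdOrthonormalBasis ℝ (TangentSpace I x)).sum_repr' (Z x)
  have hK : koszul I X Y Z x = ∑ i, inner ℝ (stdOrthonormalBasis ℝ (TangentSpace I x) i) (Z x) *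
      koszul I X Y (FiberBundle.extend E (stdOrthonormalBasis ℝ (TangentSpace I x) i)) x := by
    rw [← TensorialAt.mkHom_apply (koszul_tensorial_right hX hY) hZ]
    conv_lhs => rw [← hb]
    simp [map_sum, hZe]
  rw [hK, leviCivitaFun, dif_pos hY]
  simp only [sum_apply, ContinuousLinearMap.smulRight_apply, smul_apply, sum_inner, Finset.mul_sum]
  refine Finset.sum_congr rfl fun i _ ↦ ?_
  rw [TensorialAt.mkHom_apply _ hX, inner_smul_left]
  simp
  ring

theorem inner_leviCivitaFun_extend {Y : Π x : M, TangentSpace I x} {x : M}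
    (hY : MDiffAt (T% Y) x) (u w : TangentSpace I x) :
    inner ℝ (leviCivitaFun I Y x u) w =
      1 / 2 * koszul I (FiberBundle.extend E u) Y (FiberBundle.extend E w) x := by
  simpa using inner_leviCivitaFun (FiberBundle.mdifferentiableAt_extend I E u) hY
    (FiberBundle.mdifferentiableAt_extend I E w)

theorem isCovariantDerivativeOn_leviCivitaFun :
    IsCovariantDerivativeOn E (leviCivitaFun I (M := M)) Set.univ where
  add {Y Y' x} hY hY' _ := by
    ext u
    refine ext_inner_right ℝ fun w ↦ ?_
    rw [add_apply, inner_add_left, inner_leviCivitaFun_extend hY,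
      inner_leviCivitaFun_extend hY', inner_leviCivitaFun_extend (mdifferentiableAt_add_section hY hY'),
      koszul_add_mid (FiberBundle.mdifferentiableAt_extend ..) hY hY'
        (FiberBundle.mdifferentiableAt_extend ..)]
    ring
  leibniz {Y f x} hY hf _ := by
    ext u
    refine ext_inner_right ℝ fun w ↦ ?_
    rw [add_apply, inner_add_left, smul_apply, inner_smul_left, inner_leviCivitaFun_extend hY,
      inner_leviCivitaFun_extend (hf.smul_section hY),
      koszul_smul_mid hf (FiberBundle.mdifferentiableAt_extend ..) hY
        (FiberBundle.mdifferentiableAt_extend ..)]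
    simp [inner_smul_left]
    ring

variable (I M) in
/-- The Levi-Civita connection of the Riemannian metric on `M`. `leviCivita I M Y x (X x)` is
`∇_X Y` at `x`. -/
noncomputable def leviCivita : CovariantDerivative I E (TangentSpace I : M → Type _) where
  toFun := leviCivitaFun I
  isCovariantDerivativeOnUniv := isCovariantDerivativeOn_leviCivitaFun

/-- The Levi-Civita connection is torsion-free. -/
theorem leviCivita_sub_leviCivita {X Y : Π x : M, TangentSpace I x} {x : M}
    (hX : MDiffAt (T% X) x) (hY : MDiffAt (T% Y) x) :
    leviCivita I M Y x (X x) - leviCivita I M X x (Y x) = VectorField.mlieBracket I X Y x := by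
  refine ext_inner_right ℝ fun w ↦ ?_
  have hw := FiberBundle.mdifferentiableAt_extend I E w
  have h1 := inner_leviCivitaFun hX hY hw
  have h2 := inner_leviCivitaFun hY hX hw
  rw [FiberBundle.extend_apply_self] at h1 h2
  have h3 : VectorField.mlieBracket I Y X x = - VectorField.mlieBracket I X Y x :=
    VectorField.mlieBracket_swap_apply
  have h4 : (fun y ↦ inner ℝ (Y y) (X y) : M → ℝ) = fun y ↦ inner ℝ (X y) (Y y) :=
    funext fun y ↦ real_inner_comm _ _
  rw [inner_sub_left]
  refine (congrArg₂ (· - ·) h1 h2).trans ?_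
  simp only [koszul, h3, h4, inner_neg_left, FiberBundle.extend_apply_self]
  ring

/-- The Levi-Civita connection is compatible with the metric. -/
theorem mvfderiv_inner_eq_leviCivita {X Y Z : Π x : M, TangentSpace I x} {x : M}
    (hX : MDiffAt (T% X) x) (hY : MDiffAt (T% Y) x) (hZ : MDiffAt (T% Z) x) :
    mvfderiv I (fun y ↦ inner ℝ (Y y) (Z y)) x (X x) =
      inner ℝ (leviCivita I M Y x (X x)) (Z x) + inner ℝ (Y x) (leviCivita I M Z x (X x)) := by
  have h1 := inner_leviCivitaFun hX hY hZ
  have h2 := inner_leviCivitaFun hX hZ hY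
  have h3 : VectorField.mlieBracket I Z Y x = - VectorField.mlieBracket I Y Z x :=
    VectorField.mlieBracket_swap_apply
  have h4 : (fun y ↦ inner ℝ (Z y) (Y y) : M → ℝ) = fun y ↦ inner ℝ (Y y) (Z y) :=
    funext fun y ↦ real_inner_comm _ _
  rw [real_inner_comm _ (Y x)]
  refine Eq.trans ?_ (congrArg₂ (· + ·) h1 h2).symm
  simp only [koszul, h3, h4, inner_neg_left]
  ring

/-! ### Curvature

Vectors of the tangent space at `x` are extended by `FiberBundle.extend` to vector fields that are
smooth near `x`; by tensoriality the choice of the extension is immaterial. -/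

variable (I) in
/-- `R(X,Y)Z = ∇_X ∇_Y Z - ∇_Y ∇_X Z - ∇_[X,Y] Z` for vector fields. -/
noncomputable def curvatureField (X Y Z : Π x : M, TangentSpace I x) (x : M) : TangentSpace I x :=
  leviCivita I M (fun y ↦ leviCivita I M Z y (Y y)) x (X x)
    - leviCivita I M (fun y ↦ leviCivita I M Z y (X y)) x (Y x)
    - leviCivita I M Z x (VectorField.mlieBracket I X Y x)

variable (I) in
/-- The curvature tensor `R(u,v)w` at the point `x`. -/
noncomputable def curvature (x : M) (u v w : TangentSpace I x) : TangentSpace I x :=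
  curvatureField I (FiberBundle.extend E u) (FiberBundle.extend E v) (FiberBundle.extend E w) x

variable (I) in
/-- An orthonormal basis of the tangent space at `x`. -/
noncomputable def frame (x : M) :
    OrthonormalBasis (Fin (Module.finrank ℝ (TangentSpace I x))) ℝ (TangentSpace I x) :=
  stdOrthonormalBasis ℝ (TangentSpace I x)

variable (I) in
/-- The Ricci tensor `Ric(v,w)`, the trace of `u ↦ R(u,v)w`. -/
noncomputable def ricci (x : M) (v w : TangentSpace I x) : ℝ :=
  ∑ i, inner ℝ (curvature I x (frame I x i) v w) (frame I x i)

variable (I) in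
/-- The Ricci operator `Q`, with `⟨Q v, w⟩ = Ric(v,w)`. -/
noncomputable def ricciOperator (x : M) (v : TangentSpace I x) : TangentSpace I x :=
  ∑ i, ricci I x v (frame I x i) • frame I x i

variable (I) in
/-- The scalar curvature `r`. -/
noncomputable def scalarCurvature (x : M) : ℝ :=
  ∑ i, ricci I x (frame I x i) (frame I x i)

variable (I) in
/-- The Weyl conformal curvature tensor `C(X,Y)Z` of a manifold of dimension `2n+1`. -/
noncomputable def weyl (n : ℕ) (x : M) (X Y Z : TangentSpace I x) : TangentSpace I x :=
  curvature I x X Y Z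
    - (1 / (2 * (n : ℝ) - 1)) •
      (ricci I x Y Z • X - ricci I x X Z • Y
        + (inner ℝ Y Z : ℝ) • ricciOperator I x X - (inner ℝ X Z : ℝ) • ricciOperator I x Y)
    + (scalarCurvature I x / (2 * (n : ℝ) * (2 * (n : ℝ) - 1))) •
      ((inner ℝ Y Z : ℝ) • X - (inner ℝ X Z : ℝ) • Y)

variable (I M) in
/-- The Weyl conformal curvature tensor vanishes identically. -/
def IsWeylFlat (n : ℕ) : Prop :=
  ∀ (x : M) (X Y Z : TangentSpace I x), weyl I n x X Y Z = 0

variable (I) in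
/-- The Schouten tensor `(1/(2n-1)) (Ric - (r/(4n)) g)` of a manifold of dimension `2n+1`. -/
noncomputable def schouten (n : ℕ) (x : M) (v w : TangentSpace I x) : ℝ :=
  1 / (2 * (n : ℝ) - 1) * (ricci I x v w - scalarCurvature I x / (4 * (n : ℝ)) * inner ℝ v w)

variable (I) in
/-- `(∇_X P)(Y,Z)` for the Schouten tensor `P` and vector fields `X`, `Y`, `Z`. -/
noncomputable def covDerivSchouten (n : ℕ) (X Y Z : Π x : M, TangentSpace I x) (x : M) : ℝ :=
  mvfderiv I (fun y ↦ schouten I n y (Y y) (Z y)) x (X x)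
    - schouten I n x (leviCivita I M Y x (X x)) (Z x)
    - schouten I n x (Y x) (leviCivita I M Z x (X x))

variable (I M) in
/-- The Cotton tensor `(∇_X P)(Y,Z) - (∇_Y P)(X,Z)` vanishes identically. -/
def IsCottonFlat (n : ℕ) : Prop :=
  ∀ (x : M) (X Y Z : Π x : M, TangentSpace I x),
    CMDiffAt ∞ (T% X) x → CMDiffAt ∞ (T% Y) x → CMDiffAt ∞ (T% Z) x →
      covDerivSchouten I n X Y Z x - covDerivSchouten I n Y X Z x = 0

variable (I M) in
/-- Conformal flatness of a Riemannian manifold of dimension `2n+1 ≥ 3`: the Weyl tensor vanishes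
and, in dimension `3`, where the Weyl tensor vanishes for every metric, the Cotton tensor vanishes
as well. -/
def IsConformallyFlat (n : ℕ) : Prop :=
  IsWeylFlat I M n ∧ (n = 1 → IsCottonFlat I M n)

/-! ### Almost contact metric and Sasakian structures -/

variable (I M) in
/-- An almost contact metric structure `(φ, ξ, η, g)`, where `g` is the Riemannian metric
of `M`. -/
structure AlmostContactMetricStructure where
  /-- The `(1,1)`-tensor field `φ`. -/
  phi : Π x : M, TangentSpace I x →L[ℝ] TangentSpace I x
  /-- The vector field `ξ`. -/
  xi : Π x : M, TangentSpace I x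
  /-- The `1`-form `η`. -/
  eta : Π x : M, TangentSpace I x →L[ℝ] ℝ
  contMDiff_phi : ContMDiff I (I.prod 𝓘(ℝ, E →L[ℝ] E)) ∞
    (fun x ↦ TotalSpace.mk' (E →L[ℝ] E) (E := fun x : M ↦ TangentSpace I x →L[ℝ] TangentSpace I x)
      x (phi x))
  contMDiff_xi : CMDiff ∞ (T% xi)
  contMDiff_eta : ContMDiff I (I.prod 𝓘(ℝ, E →L[ℝ] ℝ)) ∞
    (fun x ↦ TotalSpace.mk' (E →L[ℝ] ℝ) (E := fun x : M ↦ TangentSpace I x →L[ℝ] ℝ) x (eta x))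
  phi_phi (x : M) (v : TangentSpace I x) : phi x (phi x v) = -v + eta x v • xi x
  eta_xi (x : M) : eta x (xi x) = 1
  phi_xi (x : M) : phi x (xi x) = 0
  eta_phi (x : M) (v : TangentSpace I x) : eta x (phi x v) = 0
  inner_phi_phi (x : M) (v w : TangentSpace I x) :
    (inner ℝ (phi x v) (phi x w) : ℝ) = inner ℝ v w - eta x v * eta x w

namespace AlmostContactMetricStructure

variable (S : AlmostContactMetricStructure I M)

/-- `dη(X,Y) = (X η(Y) - Y η(X) - η([X,Y])) / 2` for vector fields. -/
noncomputable def dEta (X Y : Π x : M, TangentSpace I x) (x : M) : ℝ :=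
  1 / 2 * (mvfderiv I (fun y ↦ S.eta y (Y y)) x (X x) - mvfderiv I (fun y ↦ S.eta y (X y)) x (Y x)
    - S.eta x (VectorField.mlieBracket I X Y x))

/-- Contact metric structure: `dη(X,Y) = g(X, φY)`. -/
def IsContactMetric : Prop :=
  ∀ (x : M) (X Y : Π x : M, TangentSpace I x), MDiffAt (T% X) x → MDiffAt (T% Y) x →
    S.dEta X Y x = inner ℝ (X x) (S.phi x (Y x))

/-- The Nijenhuis tensor
`[φ,φ](X,Y) = φ²[X,Y] + [φX,φY] - φ[φX,Y] - φ[X,φY]` for vector fields. -/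
noncomputable def nijenhuis (X Y : Π x : M, TangentSpace I x) (x : M) : TangentSpace I x :=
  S.phi x (S.phi x (VectorField.mlieBracket I X Y x))
    + VectorField.mlieBracket I (fun y ↦ S.phi y (X y)) (fun y ↦ S.phi y (Y y)) x
    - S.phi x (VectorField.mlieBracket I (fun y ↦ S.phi y (X y)) Y x)
    - S.phi x (VectorField.mlieBracket I X (fun y ↦ S.phi y (Y y)) x)

/-- Normality: `[φ,φ] + 2 dη ⊗ ξ = 0`. -/
def IsNormal : Prop :=
  ∀ (x : M) (X Y : Π x : M, TangentSpace I x), MDiffAt (T% X) x → MDiffAt (T% Y) x →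
    S.nijenhuis X Y x + (2 * S.dEta X Y x) • S.xi x = 0

/-- A Sasakian structure is a normal contact metric structure. -/
def IsSasakian : Prop := S.IsContactMetric ∧ S.IsNormal

/-- The `*`-Ricci tensor `Ric*(X,Y) = ∑ i, g(R(X,e_i)φe_i, φY)`. -/
noncomputable def starRicci (x : M) (X Y : TangentSpace I x) : ℝ :=
  ∑ i, inner ℝ (curvature I x X (frame I x i) (S.phi x (frame I x i))) (S.phi x Y)

/-- The symmetric part `Ric^φ` of the `*`-Ricci tensor. -/
noncomputable def phiRicci (x : M) (X Y : TangentSpace I x) : ℝ :=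
  1 / 2 * (S.starRicci x X Y + S.starRicci x Y X)

/-- `g^φ(X,Y) = g(φX, φY)`. -/
noncomputable def phiMetric (x : M) (X Y : TangentSpace I x) : ℝ :=
  inner ℝ (S.phi x X) (S.phi x Y)

/-- `φ`-Einstein: `Ric^φ = β g^φ` for some constant `β`. -/
def IsPhiEinstein : Prop :=
  ∃ β : ℝ, ∀ (x : M) (X Y : TangentSpace I x), S.phiRicci x X Y = β * S.phiMetric x X Y

end AlmostContactMetricStructure

end Riemannian

end SasakianGeometry

/-!
On a Sasakian manifold the structure equations determine the first derivatives of the structure: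
`∇_u ξ = -φ u` and `(∇_u φ) v = ⟨u, v⟩ ξ - η(v) u` (`IsSasakian.leviCivita_xi`,
`IsSasakian.nablaPhi_eq`). They follow by linear algebra at a point (`nabla_xi_of_structure`,
`nabla_phi_of_structure`) from normality, the contact condition and the closedness of `dη`.
Differentiating them once more gives `R(u,v)ξ = η(v) u - η(u) v` (`IsSasakian.curvature_xi`),
hence `Ric(v,ξ) = 2n η(v)`, and a formula for `R(u,v)φ - φR(u,v)` (`IsSasakian.curvature_phi`).

If the Weyl tensor vanishes, its value on `(u, ξ, ξ)` can be solved for the Ricci tensor, which is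
therefore a combination of `g` and `η ⊗ η` with coefficients depending on `r`
(`IsSasakian.ricci_of_isWeylFlat`). Substituting this back, the curvature `⟨R(u,v)w, z⟩` with `w`,
`z` orthogonal to `ξ` is that of a space form with factor `c = (r - 4n) / (2n(2n-1))`, and tracing
yields `Ric* = c g^φ`.

For conformally flat `M` the factor `c` is `1` at every point, which fixes the scalar
curvature. If `n ≥ 2`, there is a vector `v` orthogonal to `u`, `φu` and `ξ`,
and the formula for `R(u,v)φu - φR(u,v)u` gives `c = 1`. If `n = 1`, the component of the Cotton
tensor on `φu`, `u`, `ξ` is a nonzero multiple of `r - 6`.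

The curvature identities in use (skew-adjointness, the Bianchi identity, pair symmetry,
tensoriality in the third argument) rest on `[X, Y] f = X (Y f) - Y (X f)`, on the Jacobi
identity, and on the smoothness of `∇_X Y`, which the Koszul formula gives only in weak form, that
is, after pairing with vector fields (`contMDiffAt_of_contMDiffAt_inner`).
-/

namespace SasakianGeometry

set_option linter.unusedSectionVars false

/-! ### Derivatives along vector fields and the Lie bracket -/

section Smoothness

variable {E : Type*} [NormedAddCommGroup E] [NormedSpace ℝ E] [FiniteDimensional ℝ E]
  {H : Type*} [TopologicalSpace H] {I : ModelWithCorners ℝ E H}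
  {M : Type*} [TopologicalSpace M] [ChartedSpace H M] [IsManifold I ∞ M]

/-- `C^∞` at a point means `C^k` near the point for each `k`, on neighbourhoods depending on `k`;
for `k = 1` this provides differentiability nearby. -/
theorem eventually_mdiffAt {X : Π x : M, TangentSpace I x} {x : M}
    (hX : CMDiffAt ∞ (T% X) x) : ∀ᶠ y in nhds x, MDiffAt (T% X) y := by
  have h1 : CMDiffAt 1 (T% X) x := hX.of_le (by simp)
  have h2 := (contMDiffAt_iff_contMDiffAt_nhds (by simp)).1 h1
  filter_upwards [h2] with y hy
  exact hy.mdifferentiableAt one_ne_zero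

/-- The derivative `X f` of a smooth function along a smooth vector field is smooth. -/
theorem contMDiffAt_mvfderiv_apply {X : Π x : M, TangentSpace I x} {f : M → ℝ} {x : M}
    (hf : CMDiffAt ∞ f x) (hX : CMDiffAt ∞ (T% X) x) :
    CMDiffAt ∞ (fun y ↦ mvfderiv I f y (X y)) x := by
  have h1 := hf.mfderiv_const (m := ∞) (by simp)
  have h2 := ContMDiffAt.clm_apply_of_inCoordinates (b₁ := fun y : M ↦ y) (b₂ := f)
    (ϕ := mfderiv I 𝓘(ℝ) f) (n := ∞) (m₀ := x) h1 hX hf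
  rw [contMDiffAt_totalSpace] at h2
  refine ContMDiffAt.congr_of_eventuallyEq h2.2 (Filter.Eventually.of_forall fun y ↦ ?_)
  simp [mvfderiv]
  rfl

theorem mvfderiv_congr_of_eventuallyEq {f g : M → ℝ} {x : M} (h : f =ᶠ[nhds x] g) :
    mvfderiv I f x = mvfderiv I g x := by
  ext u
  simp [mvfderiv, h.mfderiv_eq]
  rfl

theorem mvfderiv_const_mul_sub_sub (c : ℝ) {f g k : M → ℝ} {x : M} (hf : MDiffAt f x)
    (hg : MDiffAt g x) (hk : MDiffAt k x) (u : TangentSpace I x) :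
    mvfderiv I (fun y ↦ c * (f y - g y - k y)) x u
      = c * (mvfderiv I f x u - mvfderiv I g x u - mvfderiv I k x u) := by
  have hfg : MDiffAt (fun y ↦ f y - g y) x := hf.sub hg
  have hfgk : MDiffAt (fun y ↦ f y - g y - k y) x := hfg.sub hk
  have hc : mvfderiv I (fun _ : M ↦ c) x = 0 := mvfderiv_const ..
  have h : MDiffAt (fun _ : M ↦ c) x := mdifferentiableAt_const
  rw [mvfderiv_fun_mul h hfgk, hc, mvfderiv_fun_sub hfg hk, mvfderiv_fun_sub hf hg]
  simp

variable (I M) in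
theorem isManifold_minSmoothness (k : ℕ∞) : IsManifold I (minSmoothness ℝ k) M := by
  rw [minSmoothness_of_isRCLikeNormedField]
  exact IsManifold.of_le (mod_cast le_top : ((k : ℕ∞) : WithTop ℕ∞) ≤ ((⊤ : ℕ∞) : WithTop ℕ∞))

theorem contMDiffAt_mlieBracket {X Y : Π x : M, TangentSpace I x} {x : M}
    (hX : CMDiffAt ∞ (T% X) x) (hY : CMDiffAt ∞ (T% Y) x) :
    CMDiffAt ∞ (T% (VectorField.mlieBracket I X Y)) x := by
  have : IsManifold I (((⊤ : ℕ∞) : WithTop ℕ∞) + 1) M := by simpa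
  have := isManifold_minSmoothness I M 2
  exact ContMDiffAt.mlieBracket_vectorField (m := ⊤) (n := ⊤) hX hY (by simp)

/-- The product rule for an iterated Lie bracket; its first coefficient is `X (Y f)`. -/
theorem mlieBracket_mlieBracket_smul {X Y W : Π x : M, TangentSpace I x} {f : M → ℝ} {x : M}
    (hf : CMDiffAt ∞ f x) (hY : CMDiffAt ∞ (T% Y) x)
    (hW : CMDiffAt ∞ (T% W) x) :
    VectorField.mlieBracket I X (VectorField.mlieBracket I Y (f • W)) x
      = mvfderiv I (fun y ↦ mvfderiv I f y (Y y)) x (X x) • W x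
        + mvfderiv I f x (Y x) • VectorField.mlieBracket I X W x
        + (mvfderiv I f x (X x) • VectorField.mlieBracket I Y W x
        + f x • VectorField.mlieBracket I X (VectorField.mlieBracket I Y W) x) := by
  have hdf := contMDiffAt_mvfderiv_apply hf hY
  have hYW := contMDiffAt_mlieBracket hY hW
  have h1 : VectorField.mlieBracket I Y (f • W) =ᶠ[nhds x]
      (fun y ↦ mvfderiv I f y (Y y)) • W + f • VectorField.mlieBracket I Y W := by
    have h2 := (contMDiffAt_iff_contMDiffAt_nhds (n := 1) (by simp)).1 (hf.of_le (by simp))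
    filter_upwards [h2, eventually_mdiffAt hW] with y hy hy'
    exact VectorField.mlieBracket_smul_right (hy.mdifferentiableAt one_ne_zero) hy'
  have h0 : (∞ : WithTop ℕ∞) ≠ 0 := by simp
  rw [Filter.EventuallyEq.mlieBracket_vectorField_eq (Filter.EventuallyEq.refl _ X) h1,
    VectorField.mlieBracket_add_right, VectorField.mlieBracket_smul_right,
    VectorField.mlieBracket_smul_right]
  · exact hf.mdifferentiableAt h0
  · exact hYW.mdifferentiableAt h0
  · exact hdf.mdifferentiableAt h0
  · exact hW.mdifferentiableAt h0
  · exact (hdf.mdifferentiableAt h0).smul_section (hW.mdifferentiableAt h0)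
  · exact (hf.mdifferentiableAt h0).smul_section (hYW.mdifferentiableAt h0)

theorem mlieBracket_jacobi {X Y Z : Π x : M, TangentSpace I x} {x : M}
    (hX : CMDiffAt ∞ (T% X) x) (hY : CMDiffAt ∞ (T% Y) x) (hZ : CMDiffAt ∞ (T% Z) x) :
    VectorField.mlieBracket I X (VectorField.mlieBracket I Y Z) x =
      VectorField.mlieBracket I (VectorField.mlieBracket I X Y) Z x +
        VectorField.mlieBracket I Y (VectorField.mlieBracket I X Z) x := by
  have := isManifold_minSmoothness I M 3
  have h2 : minSmoothness ℝ 2 ≤ ∞ := by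
    rw [minSmoothness_of_isRCLikeNormedField]
    exact (mod_cast le_top : ((2 : ℕ∞) : WithTop ℕ∞) ≤ ((⊤ : ℕ∞) : WithTop ℕ∞))
  exact VectorField.leibniz_identity_mlieBracket_apply (hX.of_le h2) (hY.of_le h2) (hZ.of_le h2)

/-- The Lie bracket acts on functions as the commutator: `[X, Y] f = X (Y f) - Y (X f)`. This is
the coefficient of `W` in the Jacobi identity for `X`, `Y` and `f W`, where `W` does not vanish at
the point. -/
theorem mvfderiv_mlieBracket {X Y : Π x : M, TangentSpace I x} {f : M → ℝ} {x : M}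
    (hf : CMDiffAt ∞ f x) (hX : CMDiffAt ∞ (T% X) x) (hY : CMDiffAt ∞ (T% Y) x) :
    mvfderiv I f x (VectorField.mlieBracket I X Y x)
      = mvfderiv I (fun y ↦ mvfderiv I f y (Y y)) x (X x)
        - mvfderiv I (fun y ↦ mvfderiv I f y (X y)) x (Y x) := by
  have h0 : (∞ : WithTop ℕ∞) ≠ 0 := by simp
  rcases subsingleton_or_nontrivial (TangentSpace I x) with hs | hs
  · rw [Subsingleton.elim (VectorField.mlieBracket I X Y x) 0, Subsingleton.elim (X x) 0,
      Subsingleton.elim (Y x) 0]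
    simp
  obtain ⟨w, hw⟩ := exists_ne (0 : TangentSpace I x)
  have hW : CMDiffAt ∞ (T% (FiberBundle.extend E w)) x := FiberBundle.contMDiffAt_extend I E w
  set W := FiberBundle.extend E w with hWdef
  have hWx : W x = w := FiberBundle.extend_apply_self ..
  have hfW : CMDiffAt ∞ (T% (f • W)) x := hf.smul_section hW
  have hJ := mlieBracket_jacobi hX hY hfW
  have hJ' := mlieBracket_jacobi hX hY hW
  rw [mlieBracket_mlieBracket_smul hf hY hW, mlieBracket_mlieBracket_smul hf hX hW,
    VectorField.mlieBracket_smul_right (hf.mdifferentiableAt h0) (hW.mdifferentiableAt h0), hJ',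
    hWx] at hJ
  have hk : (mvfderiv I (fun y ↦ mvfderiv I f y (Y y)) x (X x)
        - mvfderiv I (fun y ↦ mvfderiv I f y (X y)) x (Y x)
      - mvfderiv I f x (VectorField.mlieBracket I X Y x)) • w = 0 := by
    rw [← sub_eq_zero] at hJ
    rw [← hJ]
    module
  rcases smul_eq_zero.1 hk with h | h
  · linarith
  · exact absurd h hw

end Smoothness

/-! ### Smoothness of the Levi-Civita connection -/

section Riemannian

variable {E : Type*} [NormedAddCommGroup E] [NormedSpace ℝ E] [FiniteDimensional ℝ E]
  {H : Type*} [TopologicalSpace H] {I : ModelWithCorners ℝ E H}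
  {M : Type*} [TopologicalSpace M] [ChartedSpace H M] [IsManifold I ∞ M]
  [RiemannianBundle (fun x : M ↦ TangentSpace I x)]
  [IsContMDiffRiemannianBundle I ∞ E (fun x : M ↦ TangentSpace I x)]

theorem contMDiffAt_inner {X Z : Π x : M, TangentSpace I x} {x : M}
    (hX : CMDiffAt ∞ (T% X) x) (hZ : CMDiffAt ∞ (T% Z) x) :
    CMDiffAt ∞ (fun y ↦ (inner ℝ (X y) (Z y) : ℝ)) x :=
  ContMDiffAt.inner_bundle (E := fun x : M ↦ TangentSpace I x) (b := fun y ↦ y) hX hZ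

/-- Smoothness of a vector field can be tested by pairing with smooth vector fields: the
coefficients in a local frame are recovered from the pairings with the frame by inverting the Gram
matrix, and inversion is smooth. -/
theorem contMDiffAt_of_contMDiffAt_inner {V : Π x : M, TangentSpace I x} {x : M}
    (hV : ∀ W : Π x : M, TangentSpace I x, CMDiffAt ∞ (T% W) x →
      CMDiffAt ∞ (fun y ↦ (inner ℝ (V y) (W y) : ℝ)) x) :
    CMDiffAt ∞ (T% V) x := by
  let e := trivializationAt E (TangentSpace I : M → Type _) x
  have hx : x ∈ e.baseSet := FiberBundle.mem_baseSet_trivializationAt E (TangentSpace I) x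
  obtain ⟨d, ⟨b⟩⟩ : ∃ d : ℕ, Nonempty (Module.Basis (Fin d) ℝ E) := ⟨_, ⟨Module.finBasis ℝ E⟩⟩
  let s : Fin d → Π x : M, TangentSpace I x := e.localFrame b
  have hs (i : Fin d) : CMDiffAt ∞ (T% (s i)) x := contMDiffAt_localFrame_of_mem ∞ e b i hx
  let G : Fin d → Fin d → M → ℝ :=
    fun i j y ↦ inner ℝ (s i y) (s j y)
  -- `T i j` is the elementary matrix carrying the `i`-th coordinate to the `j`-th, so that `B y` is
  -- the Gram matrix of the frame at `y`, acting on coefficient vectors.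
  let T : Fin d → Fin d → ((Fin d → ℝ) →L[ℝ] (Fin d → ℝ)) := fun i j ↦
    (ContinuousLinearMap.proj (R := ℝ) i).smulRight (Pi.single j (1 : ℝ) : Fin d → ℝ)
  let B : M → ((Fin d → ℝ) →L[ℝ] (Fin d → ℝ)) := fun y ↦ ∑ i, ∑ j, G i j y • T i j
  let w : M → (Fin d → ℝ) := fun y j ↦ inner ℝ (V y) (s j y)
  have hBapp (y : M) (c : Fin d → ℝ) (j : Fin d) : B y c j = ∑ i, c i * G i j y := by
    simp [B, T, Finset.sum_apply, Pi.single_apply, mul_comm]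
  have hG (i j : Fin d) : CMDiffAt ∞ (G i j) x := contMDiffAt_inner (hs i) (hs j)
  have hB : CMDiffAt ∞ B x := by
    refine ContMDiffAt.sum fun i _ ↦ ContMDiffAt.sum fun j _ ↦ ?_
    exact (hG i j).smul contMDiffAt_const
  have hw : ContMDiffAt I 𝓘(ℝ, Fin d → ℝ) ∞ w x := contMDiffAt_pi_space.2 fun j ↦ hV _ (hs j)
  let c : M → (Fin d → ℝ) := fun y i ↦ e.localFrameCoeff I b i y (V y)
  -- The Gram matrix of a frame is injective, as its quadratic form is the squared length.
  have hBinv (y : M) (hy : y ∈ e.baseSet) : (B y).IsInvertible := by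
    have hinj : Function.Injective (B y) := by
      rw [injective_iff_map_eq_zero]
      intro a ha
      have h1 (j : Fin d) : inner ℝ (∑ i, a i • s i y) (s j y) = (0 : ℝ) := by
        have := congrFun ha j
        rw [hBapp] at this
        simpa [sum_inner, inner_smul_left] using this
      have h2 : ∑ i, a i • s i y = 0 := by
        rw [← inner_self_eq_zero (𝕜 := ℝ), inner_sum]
        simp [inner_smul_right, h1]
      have hli := ((e.isLocalFrameOn_localFrame_baseSet I ∞ b).linearIndependent hy)
      funext i
      exact Fintype.linearIndependent_iff.1 hli a h2 i
    let L := LinearEquiv.ofInjectiveEndo (B y : (Fin d → ℝ) →ₗ[ℝ] (Fin d → ℝ)) hinj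
    exact ⟨L.toContinuousLinearEquiv, by ext; rfl⟩
  have hc (y : M) (hy : y ∈ e.baseSet) : c y = (B y).inverse (w y) := by
    have h1 : B y (c y) = w y := by
      funext j
      rw [hBapp]
      have := e.eq_sum_localFrameCoeff_smul (I := I) (b := b) (s := V) hy
      simp only [w]
      conv_rhs => rw [this]
      simp [sum_inner, inner_smul_left, c, G, s]
    rw [← h1]
    obtain ⟨L, hL⟩ := hBinv y hy
    rw [← hL]
    simp
  have hcs : ContMDiffAt I 𝓘(ℝ, Fin d → ℝ) ∞ c x := by
    have h1 : ContMDiffAt I 𝓘(ℝ, Fin d → ℝ) ∞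
        (fun y ↦ (B y).inverse (w y)) x := by
      have h2 : CMDiffAt ∞ (fun y ↦ (B y).inverse) x :=
        (hBinv x hx).contDiffAt_map_inverse.contMDiffAt.comp x hB
      exact h2.clm_apply hw
    refine h1.congr_of_eventuallyEq ?_
    filter_upwards [e.open_baseSet.mem_nhds hx] with y hy using hc y hy
  rw [contMDiffAt_iff_localFrameCoeff (e := e) (I := I) b hx]
  intro i
  exact contMDiffAt_pi_space.1 hcs i

theorem contMDiffAt_koszul {X Y Z : Π x : M, TangentSpace I x} {x : M}
    (hX : CMDiffAt ∞ (T% X) x) (hY : CMDiffAt ∞ (T% Y) x) (hZ : CMDiffAt ∞ (T% Z) x) :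
    CMDiffAt ∞ (koszul I X Y Z) x := by
  refine ContMDiffAt.sub (ContMDiffAt.sub (ContMDiffAt.add (ContMDiffAt.sub (ContMDiffAt.add
    ?_ ?_) ?_) ?_) ?_) ?_
  · exact contMDiffAt_mvfderiv_apply (contMDiffAt_inner hY hZ) hX
  · exact contMDiffAt_mvfderiv_apply (contMDiffAt_inner hX hZ) hY
  · exact contMDiffAt_mvfderiv_apply (contMDiffAt_inner hX hY) hZ
  · exact contMDiffAt_inner (contMDiffAt_mlieBracket hX hY) hZ
  · exact contMDiffAt_inner (contMDiffAt_mlieBracket hX hZ) hY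
  · exact contMDiffAt_inner (contMDiffAt_mlieBracket hY hZ) hX

theorem contMDiffAt_leviCivita {X Y : Π x : M, TangentSpace I x} {x : M}
    (hX : CMDiffAt ∞ (T% X) x) (hY : CMDiffAt ∞ (T% Y) x) :
    CMDiffAt ∞ (T% (fun y ↦ leviCivita I M Y y (X y))) x := by
  refine contMDiffAt_of_contMDiffAt_inner fun W hW ↦ ?_
  have h1 : CMDiffAt ∞ (fun y ↦ 1 / 2 * koszul I X Y W y) x :=
    contMDiffAt_const.mul (contMDiffAt_koszul hX hY hW)
  refine h1.congr_of_eventuallyEq ?_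
  filter_upwards [eventually_mdiffAt hX, eventually_mdiffAt hY, eventually_mdiffAt hW]
    with y h1 h2 h3
  exact inner_leviCivitaFun h1 h2 h3

end Riemannian

/-! ### Symmetries of the curvature tensor -/

section Curvature

variable {E : Type*} [NormedAddCommGroup E] [NormedSpace ℝ E] [FiniteDimensional ℝ E]
  {H : Type*} [TopologicalSpace H] {I : ModelWithCorners ℝ E H}
  {M : Type*} [TopologicalSpace M] [ChartedSpace H M] [IsManifold I ∞ M]
  [RiemannianBundle (fun x : M ↦ TangentSpace I x)]
  [IsContMDiffRiemannianBundle I ∞ E (fun x : M ↦ TangentSpace I x)]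

theorem _root_.ContMDiffAt.mdiffAt_field {X : Π x : M, TangentSpace I x} {x : M}
    (hX : CMDiffAt ∞ (T% X) x) : MDiffAt (T% X) x :=
  ContMDiffAt.mdifferentiableAt hX (by simp)

theorem leviCivita_add {Y Y' : Π x : M, TangentSpace I x} {x : M}
    (hY : MDiffAt (T% Y) x) (hY' : MDiffAt (T% Y') x) (u : TangentSpace I x) :
    leviCivita I M (fun y ↦ Y y + Y' y) x u = leviCivita I M Y x u + leviCivita I M Y' x u :=
  congrArg (· u) ((leviCivita I M).isCovariantDerivativeOnUniv.add hY hY')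

theorem leviCivita_smul {Y : Π x : M, TangentSpace I x} {f : M → ℝ} {x : M}
    (hf : MDiffAt f x) (hY : MDiffAt (T% Y) x) (u : TangentSpace I x) :
    leviCivita I M (fun y ↦ f y • Y y) x u
      = f x • leviCivita I M Y x u + mvfderiv I f x u • Y x := by
  have := congrArg (· u) ((leviCivita I M).isCovariantDerivativeOnUniv.leibniz hY hf)
  simp only [add_apply, smul_apply, ContinuousLinearMap.smulRight_apply] at this
  exact this

theorem leviCivita_neg {Y : Π x : M, TangentSpace I x} {x : M}
    (hY : MDiffAt (T% Y) x) (u : TangentSpace I x) :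
    leviCivita I M (fun y ↦ -Y y) x u = -leviCivita I M Y x u := by
  have h := leviCivita_smul (f := fun _ ↦ (-1 : ℝ)) mdifferentiableAt_const hY u
  have h0 : mvfderiv I (fun _ : M ↦ (-1 : ℝ)) x = 0 := mvfderiv_const ..
  simpa [h0] using h

theorem leviCivita_sub {Y Y' : Π x : M, TangentSpace I x} {x : M}
    (hY : MDiffAt (T% Y) x) (hY' : MDiffAt (T% Y') x) (u : TangentSpace I x) :
    leviCivita I M (fun y ↦ Y y - Y' y) x u = leviCivita I M Y x u - leviCivita I M Y' x u := by
  have h := leviCivita_add hY (mdifferentiableAt_neg_section hY') u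
  simp only [sub_eq_add_neg, ← leviCivita_neg hY']
  exact h

theorem leviCivita_congr {Y Y' : Π x : M, TangentSpace I x} {x : M}
    (hY : MDiffAt (T% Y) x) (hY' : MDiffAt (T% Y') x) (h : ∀ᶠ y in nhds x, Y y = Y' y) :
    leviCivita I M Y x = leviCivita I M Y' x :=
  (leviCivita I M).isCovariantDerivativeOnUniv.congr_of_eventuallyEq hY hY' Filter.univ_mem h

/-- The second derivative of `⟨Z, W⟩`, by metric compatibility applied twice. -/
theorem mvfderiv_mvfderiv_inner {X Y Z W : Π x : M, TangentSpace I x} {x : M}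
    (hX : CMDiffAt ∞ (T% X) x) (hY : CMDiffAt ∞ (T% Y) x)
    (hZ : CMDiffAt ∞ (T% Z) x) (hW : CMDiffAt ∞ (T% W) x) :
    mvfderiv I (fun y ↦ mvfderiv I (fun z ↦ inner ℝ (Z z) (W z)) y (Y y)) x (X x) =
      inner ℝ (leviCivita I M (fun y ↦ leviCivita I M Z y (Y y)) x (X x)) (W x)
      + inner ℝ (leviCivita I M Z x (Y x)) (leviCivita I M W x (X x))
      + (inner ℝ (leviCivita I M Z x (X x)) (leviCivita I M W x (Y x))
      + inner ℝ (Z x) (leviCivita I M (fun y ↦ leviCivita I M W y (Y y)) x (X x))) := by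
  have h1 : (fun y ↦ mvfderiv I (fun z ↦ inner ℝ (Z z) (W z)) y (Y y)) =ᶠ[nhds x]
      fun y ↦ inner ℝ (leviCivita I M Z y (Y y)) (W y)
        + inner ℝ (Z y) (leviCivita I M W y (Y y)) := by
    filter_upwards [eventually_mdiffAt hY, eventually_mdiffAt hZ, eventually_mdiffAt hW]
      with y h1 h2 h3
    exact mvfderiv_inner_eq_leviCivita h1 h2 h3
  have hYZ := (contMDiffAt_leviCivita hY hZ).mdiffAt_field
  have hYW := (contMDiffAt_leviCivita hY hW).mdiffAt_field
  have hX := hX.mdiffAt_field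
  have hZ := hZ.mdiffAt_field
  have hW := hW.mdiffAt_field
  rw [mvfderiv_congr_of_eventuallyEq h1, mvfderiv_fun_add (mdiff_inner hYZ hW)
    (mdiff_inner hZ hYW), add_apply, mvfderiv_inner_eq_leviCivita hX hYZ hW,
    mvfderiv_inner_eq_leviCivita hX hZ hYW]

/-- The curvature operator `R(X,Y)` is skew-adjoint: this is `[X, Y] f = X (Y f) - Y (X f)` for
`f = ⟨Z, W⟩`. -/
theorem inner_curvatureField_swap {X Y Z W : Π x : M, TangentSpace I x} {x : M}
    (hX : CMDiffAt ∞ (T% X) x) (hY : CMDiffAt ∞ (T% Y) x)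
    (hZ : CMDiffAt ∞ (T% Z) x) (hW : CMDiffAt ∞ (T% W) x) :
    inner ℝ (curvatureField I X Y Z x) (W x) = -inner ℝ (curvatureField I X Y W x) (Z x) := by
  have h1 := mvfderiv_mlieBracket (contMDiffAt_inner hZ hW) hX hY
  rw [mvfderiv_mvfderiv_inner hX hY hZ hW, mvfderiv_mvfderiv_inner hY hX hZ hW,
    mvfderiv_inner_eq_leviCivita (contMDiffAt_mlieBracket hX hY).mdiffAt_field hZ.mdiffAt_field
      hW.mdiffAt_field] at h1
  simp only [curvatureField, inner_sub_left]
  rw [real_inner_comm (Z x), real_inner_comm (Z x), real_inner_comm (Z x)]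
  linarith

theorem curvatureField_swap (X Y Z : Π x : M, TangentSpace I x) (x : M) :
    curvatureField I X Y Z x = -curvatureField I Y X Z x := by
  have : VectorField.mlieBracket I X Y x = -VectorField.mlieBracket I Y X x :=
    VectorField.mlieBracket_swap_apply
  simp only [curvatureField, this, map_neg]
  abel

/-- The curvature depends on its third argument through the value at the point only.
Skew-adjointness reduces this to the fact that `⟨R(X,Y)W, Z⟩` involves no derivative of `Z`. -/
theorem curvatureField_congr_right {X Y Z Z' : Π x : M, TangentSpace I x} {x : M}
    (hX : CMDiffAt ∞ (T% X) x) (hY : CMDiffAt ∞ (T% Y) x)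
    (hZ : CMDiffAt ∞ (T% Z) x) (hZ' : CMDiffAt ∞ (T% Z') x) (h : Z x = Z' x) :
    curvatureField I X Y Z x = curvatureField I X Y Z' x := by
  refine ext_inner_right ℝ fun w ↦ ?_
  have hW : CMDiffAt ∞ (T% (FiberBundle.extend E w)) x := FiberBundle.contMDiffAt_extend I E w
  have h1 := inner_curvatureField_swap hX hY hZ hW
  have h2 := inner_curvatureField_swap hX hY hZ' hW
  rw [h, ← h2] at h1
  simpa using h1

/-- The first Bianchi identity. -/
theorem curvatureField_bianchi {X Y Z : Π x : M, TangentSpace I x} {x : M}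
    (hX : CMDiffAt ∞ (T% X) x) (hY : CMDiffAt ∞ (T% Y) x) (hZ : CMDiffAt ∞ (T% Z) x) :
    curvatureField I X Y Z x + curvatureField I Y Z X x + curvatureField I Z X Y x = 0 := by
  -- By torsion-freeness each cyclic group of terms is an iterated bracket, and the Jacobi identity
  -- applies.
  have key {X Y Z : Π x : M, TangentSpace I x} (hX : CMDiffAt ∞ (T% X) x)
      (hY : CMDiffAt ∞ (T% Y) x) (hZ : CMDiffAt ∞ (T% Z) x) :
      leviCivita I M (fun y ↦ leviCivita I M Z y (Y y)) x (X x)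
        - leviCivita I M (fun y ↦ leviCivita I M Y y (Z y)) x (X x)
        - leviCivita I M X x (VectorField.mlieBracket I Y Z x)
      = VectorField.mlieBracket I X (VectorField.mlieBracket I Y Z) x := by
    have hB := (contMDiffAt_mlieBracket hY hZ).mdiffAt_field
    rw [← leviCivita_sub_leviCivita hX.mdiffAt_field hB]
    congr 1
    have h1 := (contMDiffAt_leviCivita hY hZ).mdiffAt_field
    have h2 := (contMDiffAt_leviCivita hZ hY).mdiffAt_field
    rw [← leviCivita_sub h1 h2]
    congr 1
    refine leviCivita_congr (mdifferentiableAt_sub_section h1 h2) hB ?_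
    filter_upwards [eventually_mdiffAt hY, eventually_mdiffAt hZ] with y h3 h4
    exact leviCivita_sub_leviCivita h3 h4
  have hJ := mlieBracket_jacobi hX hY hZ
  have s1 : VectorField.mlieBracket I (VectorField.mlieBracket I X Y) Z x
      = -VectorField.mlieBracket I Z (VectorField.mlieBracket I X Y) x :=
    VectorField.mlieBracket_swap_apply
  have s2 : VectorField.mlieBracket I Y (VectorField.mlieBracket I X Z) x
      = -VectorField.mlieBracket I Y (VectorField.mlieBracket I Z X) x := by
    have h1 : VectorField.mlieBracket I X Z = (-1 : ℝ) • VectorField.mlieBracket I Z X := by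
      rw [VectorField.mlieBracket_swap, neg_one_smul]
    rw [h1, VectorField.mlieBracket_const_smul_right (contMDiffAt_mlieBracket hZ hX).mdiffAt_field,
      neg_one_smul]
  rw [s1, s2, ← key hX hY hZ, ← key hZ hX hY, ← key hY hZ hX, ← sub_eq_zero] at hJ
  rw [← hJ]
  simp only [curvatureField]
  abel

variable (x : M)

/-- In the third slot of the curvature tensor any smooth extension of the vector may be used. -/
theorem curvature_eq_curvatureField {Z : Π x : M, TangentSpace I x} {x : M}
    (u v : TangentSpace I x) (hZ : CMDiffAt ∞ (T% Z) x) :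
    curvature I x u v (Z x)
      = curvatureField I (FiberBundle.extend E u) (FiberBundle.extend E v) Z x :=
  curvatureField_congr_right (FiberBundle.contMDiffAt_extend I E _)
    (FiberBundle.contMDiffAt_extend I E _) (FiberBundle.contMDiffAt_extend I E _) hZ
    (FiberBundle.extend_apply_self ..)

theorem curvature_swap (u v w : TangentSpace I x) :
    curvature I x u v w = -curvature I x v u w :=
  curvatureField_swap ..

theorem inner_curvature_swap (u v w z : TangentSpace I x) :
    inner ℝ (curvature I x u v w) z = -inner ℝ (curvature I x u v z) w := by
  simpa [curvature] using inner_curvatureField_swap (FiberBundle.contMDiffAt_extend I E u)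
    (FiberBundle.contMDiffAt_extend I E v) (FiberBundle.contMDiffAt_extend I E w)
    (FiberBundle.contMDiffAt_extend I E z)

theorem curvature_bianchi (u v w : TangentSpace I x) :
    curvature I x u v w + curvature I x v w u + curvature I x w u v = 0 :=
  curvatureField_bianchi (FiberBundle.contMDiffAt_extend I E u)
    (FiberBundle.contMDiffAt_extend I E v) (FiberBundle.contMDiffAt_extend I E w)

/-- The pair symmetry of the curvature tensor. -/
theorem inner_curvature_pair (u v w z : TangentSpace I x) :
    inner ℝ (curvature I x u v w) z = inner ℝ (curvature I x w z u) v := by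
  have b (a b c d : TangentSpace I x) : inner ℝ (curvature I x a b c) d
      + inner ℝ (curvature I x b c a) d + inner ℝ (curvature I x c a b) d = (0 : ℝ) := by
    rw [← inner_add_left, ← inner_add_left, curvature_bianchi, inner_zero_left]
  have s (a b c d : TangentSpace I x) : inner ℝ (curvature I x a b c) d
      = (-inner ℝ (curvature I x b a c) d : ℝ) := by
    rw [curvature_swap, inner_neg_left]
  have t (a b c d : TangentSpace I x) : inner ℝ (curvature I x a b c) d
      = (-inner ℝ (curvature I x a b d) c : ℝ) := inner_curvature_swap x a b c d
  linarith [b u v w z, b v w z u, b w z u v, b z u v w, s u v w z, t u v w z, s v w z u,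
    t v w u z, t v w z u, s w u v z, t w u v z, s w z u v, t w z u v, t w z v u, s z v w u,
    t z v w u, s v w u z, t z u v w, s z u v w, t u v z w, s z u w v, t z u w v, t u w v z,
    s u w v z, s v z w u, t v z w u, t v z u w, s v z u w]

theorem curvature_add (u v w w' : TangentSpace I x) :
    curvature I x u v (w + w') = curvature I x u v w + curvature I x u v w' := by
  refine ext_inner_right ℝ fun z ↦ ?_
  simp only [inner_add_left, inner_curvature_swap x u v _ z, inner_add_right]
  ring

theorem curvature_smul (c : ℝ) (u v w : TangentSpace I x) :
    curvature I x u v (c • w) = c • curvature I x u v w := by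
  refine ext_inner_right ℝ fun z ↦ ?_
  simp only [inner_smul_left, inner_curvature_swap x u v _ z, inner_smul_right]
  simp

theorem ricci_symm (v w : TangentSpace I x) : ricci I x v w = ricci I x w v := by
  refine Finset.sum_congr rfl fun i _ ↦ ?_
  rw [inner_curvature_pair, curvature_swap, inner_neg_left, inner_curvature_swap, neg_neg]

theorem ricci_add_right (v w w' : TangentSpace I x) :
    ricci I x v (w + w') = ricci I x v w + ricci I x v w' := by
  simp [ricci, curvature_add, inner_add_left, Finset.sum_add_distrib]

theorem ricci_smul_right (c : ℝ) (v w : TangentSpace I x) :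
    ricci I x v (c • w) = c * ricci I x v w := by
  simp [ricci, curvature_smul, inner_smul_left, Finset.mul_sum]

theorem inner_ricciOperator (v w : TangentSpace I x) :
    inner ℝ (ricciOperator I x v) w = ricci I x v w := by
  let L : TangentSpace I x →ₗ[ℝ] ℝ :=
    { toFun := ricci I x v
      map_add' := ricci_add_right x v
      map_smul' := fun c w ↦ ricci_smul_right x c v w }
  have h : ricci I x v w = L w := rfl
  rw [h, ← (frame I x).sum_repr' w, map_sum, ricciOperator, (frame I x).sum_repr' w, sum_inner]
  refine Finset.sum_congr rfl fun i _ ↦ ?_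
  rw [inner_smul_left, map_smul]
  simp [L, mul_comm]

theorem inner_curvature_of_isWeylFlat {n : ℕ} (hW : IsWeylFlat I M n) (u v w z : TangentSpace I x) :
    inner ℝ (curvature I x u v w) z =
      1 / (2 * (n : ℝ) - 1) * (ricci I x v w * inner ℝ u z - ricci I x u w * inner ℝ v z
        + inner ℝ v w * ricci I x u z - inner ℝ u w * ricci I x v z)
      - scalarCurvature I x / (2 * (n : ℝ) * (2 * (n : ℝ) - 1)) *
        (inner ℝ v w * inner ℝ u z - inner ℝ u w * inner ℝ v z : ℝ) := by
  have h := congrArg (inner ℝ · z) (hW x u v w)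
  simp only [weyl, inner_add_left, inner_sub_left, real_inner_smul_left, inner_ricciOperator,
    inner_zero_left] at h
  linarith

end Curvature

/-! ### Linear algebra of a Sasakian structure at a point -/

section Algebra

variable {V : Type*} [NormedAddCommGroup V] [InnerProductSpace ℝ V]
  {φ : V →L[ℝ] V} {ξ : V} {η : V →L[ℝ] ℝ} {A : V →L[ℝ] V} {P : V →L[ℝ] V →L[ℝ] V}

theorem eta_eq_inner_of_phi (hηξ : η ξ = 1) (hφξ : φ ξ = 0)
    (hg : ∀ u v, inner ℝ (φ u) (φ v) = inner ℝ u v - η u * η v) (v : V) :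
    η v = inner ℝ ξ v := by
  have := hg ξ v
  rw [hφξ, inner_zero_left, hηξ] at this
  linarith

theorem inner_phi_left_of_phi (hφφ : ∀ v, φ (φ v) = -v + η v • ξ) (hηξ : η ξ = 1) (hφξ : φ ξ = 0)
    (hηφ : ∀ v, η (φ v) = 0)
    (hg : ∀ u v, inner ℝ (φ u) (φ v) = inner ℝ u v - η u * η v) (u v : V) :
    inner ℝ (φ u) v = (-inner ℝ u (φ v) : ℝ) := by
  have h1 := hg u (φ v)
  have h2 : inner ℝ (φ u) ξ = (0 : ℝ) := by
    rw [real_inner_comm, ← eta_eq_inner_of_phi hηξ hφξ hg, hηφ]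
  rw [hφφ, hηφ, inner_add_right, inner_neg_right, inner_smul_right, h2] at h1
  linarith

/-- The algebra behind `∇ξ = -φ`. Here `A u` stands for `∇_u ξ` and `P v u` for `(∇_u φ) v`; the
hypotheses `hA`, `hPc` and `hN` express the contact condition, the closedness of the fundamental
form and normality. The contact condition determines the alternating part of `∇ξ`, and normality in
direction `ξ` kills the symmetric part. -/
theorem nabla_xi_of_structure (hφφ : ∀ v, φ (φ v) = -v + η v • ξ) (hηξ : η ξ = 1) (hφξ : φ ξ = 0)
    (hηφ : ∀ v, η (φ v) = 0)
    (hg : ∀ u v, inner ℝ (φ u) (φ v) = inner ℝ u v - η u * η v)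
    (hA : ∀ u v, inner ℝ (A u) v - inner ℝ (A v) u = 2 * inner ℝ u (φ v))
    (hAξ : ∀ u, inner ℝ (A u) ξ = (0 : ℝ))
    (hPs : ∀ u v w, inner ℝ (P v u) w = (-inner ℝ (P w u) v : ℝ))
    (hPc : ∀ u v w, inner ℝ (P w u) v + inner ℝ (P u v) w + inner ℝ (P v w) u = (0 : ℝ))
    (hPξ : ∀ u, P ξ u = -φ (A u))
    (hN : ∀ u v, P v (φ u) - P u (φ v) + φ (P u v) - φ (P v u) + (2 * inner ℝ u (φ v)) • ξ = 0)
    (u : V) : A u = -φ u := by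
  have hη := eta_eq_inner_of_phi hηξ hφξ hg
  have hskew := inner_phi_left_of_phi hφφ hηξ hφξ hηφ hg
  have hAξ0 : A ξ = 0 := by
    refine ext_inner_right ℝ fun v ↦ ?_
    have := hA ξ v
    rw [hAξ, ← hη, hηφ] at this
    rw [inner_zero_left]
    linarith
  have hηA (v : V) : η (A v) = 0 := by rw [hη, real_inner_comm, hAξ]
  -- Normality contracted with `ξ` says that `∇ξ` is skew on the image of `φ`.
  have h1 (v w : V) : inner ℝ (A (φ v)) (φ w) + inner ℝ (A (φ w)) (φ v) = (0 : ℝ) := by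
    have n1 := congrArg (inner ℝ · w) (hN v ξ)
    simp only [hφξ, hPξ, map_zero, map_neg, hφφ, hηA, inner_zero_right, mul_zero, zero_smul,
      inner_add_left, inner_sub_left, inner_neg_left, inner_zero_left, hskew] at n1
    have n2 := hPc ξ (φ w) v
    have n3 := hPs v (φ w) ξ
    simp only [hPξ, inner_neg_left, hg, hηA, hskew] at n2 n3
    linarith
  have h2 (v w : V) : inner ℝ (A v) w + inner ℝ (A w) v = (0 : ℝ) := by
    have := h1 (φ v) (φ w)
    simpa [hφφ, map_add, hAξ0, inner_add_right, inner_smul_right, hAξ] using this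
  refine ext_inner_right ℝ fun v ↦ ?_
  rw [inner_neg_left, hskew]
  linarith [hA u v, h2 u v]

/-- The algebra behind `(∇_u φ) v = ⟨u, v⟩ ξ - η(v) u`, with `A` and `P` as in
`nabla_xi_of_structure`. The difference `D` of the two sides, as a trilinear form, vanishes on `ξ`,
is alternating in its last two slots with cyclic sum zero, and allows `φ` to be moved between these
slots; normality then forces `D = 0`. -/
theorem nabla_phi_of_structure (hφφ : ∀ v, φ (φ v) = -v + η v • ξ) (hηξ : η ξ = 1) (hφξ : φ ξ = 0)
    (hηφ : ∀ v, η (φ v) = 0)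
    (hg : ∀ u v, inner ℝ (φ u) (φ v) = inner ℝ u v - η u * η v)
    (hA : ∀ u, A u = -φ u)
    (hPs : ∀ u v w, inner ℝ (P v u) w = (-inner ℝ (P w u) v : ℝ))
    (hPc : ∀ u v w, inner ℝ (P w u) v + inner ℝ (P u v) w + inner ℝ (P v w) u = (0 : ℝ))
    (hP2 : ∀ u v, P (φ v) u + φ (P v u) = (inner ℝ (A u) v : ℝ) • ξ + η v • A u)
    (hPξ : ∀ u, P ξ u = -φ (A u))
    (hN : ∀ u v, P v (φ u) - P u (φ v) + φ (P u v) - φ (P v u) + (2 * inner ℝ u (φ v)) • ξ = 0)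
    (u v : V) : P v u = (inner ℝ u v : ℝ) • ξ - η v • u := by
  have hη := eta_eq_inner_of_phi hηξ hφξ hg
  have hη' (v : V) : inner ℝ v ξ = η v := by rw [hη, real_inner_comm]
  have hskew := inner_phi_left_of_phi hφφ hηξ hφξ hηφ hg
  -- `D x y z` pairs the difference of the two sides for `(∇_x φ) y` with `z`.
  let D : V → V → V → ℝ := fun x y z ↦ inner ℝ (P y x) z - inner ℝ x y * η z + η y * inner ℝ x z
  have d1 (x y z : V) : D x y z = -D x z y := by
    simp only [D]
    rw [hPs]
    ring
  have d2 (x y z : V) : D x y z + D y z x + D z x y = 0 := by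
    simp only [D]
    rw [real_inner_comm x y, real_inner_comm y z, real_inner_comm x z]
    linarith [hPc x z y]
  have d3 (x y z : V) : D x (φ y) z = D x y (φ z) := by
    have := congrArg (inner ℝ · z) (hP2 x y)
    simp only [inner_add_left, inner_smul_left, hA, inner_neg_left, hskew, ← hη] at this
    simp only [D, hηφ]
    simp at this
    linarith
  have d4 (x y z : V) : D (φ x) y z - D (φ y) x z - D y x (φ z) + D x y (φ z) = 0 := by
    have := congrArg (inner ℝ · z) (hN x y)
    simp only [inner_add_left, inner_sub_left, inner_smul_left, hskew, ← hη,
      inner_zero_left] at this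
    simp only [D, hηφ, hskew]
    rw [real_inner_comm (φ x) y, hskew x y]
    simp at this
    linarith
  have d5 (x z : V) : D x ξ z = 0 := by
    simp only [D, hPξ, hA, map_neg, neg_neg, hφφ, hη', hηξ, inner_add_left, inner_neg_left,
      inner_smul_left, ← hη]
    simp
  have d6 (x y z : V) : D x (φ (φ y)) z = -D x y z := by
    have h1 : D x (φ (φ y)) z = -D x y z + η y * D x ξ z := by
      simp only [D, hφφ, map_add, map_neg, map_smul, add_apply, neg_apply, smul_apply,
        inner_add_left, inner_add_right, inner_neg_left, inner_neg_right, inner_smul_left,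
        inner_smul_right, smul_eq_mul]
      simp
      ring
    rw [h1, d5]
    ring
  -- Trading `φ` between the slots makes the Kähler-type cancellation `2 D = 0`.
  have d7 (x y z : V) : D z x y = 0 := by
    have e1 := d4 x y (φ z)
    simp only [← d3, d6] at e1
    have e2 := d2 z (φ x) (φ y)
    rw [← d3, d6] at e2
    linarith [d1 (φ y) z (φ x), d2 x y z, d1 x y z, d1 y z x]
  refine ext_inner_right ℝ fun w ↦ ?_
  have := d7 v w u
  simp only [D] at this
  rw [inner_sub_left, inner_smul_left, inner_smul_left, ← hη]
  simp
  linarith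

theorem exists_ne_zero_inner_eq_zero {V : Type*} [NormedAddCommGroup V] [InnerProductSpace ℝ V]
    [FiniteDimensional ℝ V] {m : ℕ} (s : Fin m → V) (hm : m < Module.finrank ℝ V) :
    ∃ v : V, v ≠ 0 ∧ ∀ i, inner ℝ (s i) v = (0 : ℝ) := by
  let L : V →ₗ[ℝ] (Fin m → ℝ) := LinearMap.pi fun i ↦ (innerSL ℝ (s i) : V →ₗ[ℝ] ℝ)
  have hL : LinearMap.ker L ≠ ⊥ := LinearMap.ker_ne_bot_of_finrank_lt (by simpa using hm)
  obtain ⟨v, hv, hv0⟩ := (Submodule.ne_bot_iff _).1 hL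
  exact ⟨v, hv0, fun i ↦ congrFun (LinearMap.mem_ker.1 hv) i⟩

end Algebra

/-! ### The covariant derivative of an almost contact metric structure -/

namespace AlmostContactMetricStructure

variable {E : Type*} [NormedAddCommGroup E] [NormedSpace ℝ E] [FiniteDimensional ℝ E]
  {H : Type*} [TopologicalSpace H] {I : ModelWithCorners ℝ E H}
  {M : Type*} [TopologicalSpace M] [ChartedSpace H M] [IsManifold I ∞ M]
  [RiemannianBundle (fun x : M ↦ TangentSpace I x)]
  [IsContMDiffRiemannianBundle I ∞ E (fun x : M ↦ TangentSpace I x)]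
  (S : AlmostContactMetricStructure I M)

theorem eta_eq_inner (x : M) (v : TangentSpace I x) : S.eta x v = inner ℝ (S.xi x) v :=
  eta_eq_inner_of_phi (S.eta_xi x) (S.phi_xi x) (S.inner_phi_phi x) v

theorem inner_phi_left (x : M) (u v : TangentSpace I x) :
    inner ℝ (S.phi x u) v = (-inner ℝ u (S.phi x v) : ℝ) :=
  inner_phi_left_of_phi (S.phi_phi x) (S.eta_xi x) (S.phi_xi x) (S.eta_phi x)
    (S.inner_phi_phi x) u v

theorem inner_phi_swap (x : M) (u v : TangentSpace I x) :
    inner ℝ u (S.phi x v) = (-inner ℝ v (S.phi x u) : ℝ) := by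
  rw [← inner_phi_left, real_inner_comm]

variable {S}

theorem contMDiffAt_phi_apply {X : Π x : M, TangentSpace I x} {x : M}
    (hX : CMDiffAt ∞ (T% X) x) : CMDiffAt ∞ (T% (fun y ↦ S.phi y (X y))) x :=
  ContMDiffAt.clm_bundle_apply (E₁ := (TangentSpace I : M → Type _))
    (E₂ := (TangentSpace I : M → Type _)) (b := fun y ↦ y) (S.contMDiff_phi x) hX

theorem mdiffAt_phi_apply {X : Π x : M, TangentSpace I x} {x : M}
    (hX : MDiffAt (T% X) x) : MDiffAt (T% (fun y ↦ S.phi y (X y))) x :=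
  MDifferentiableAt.clm_bundle_apply (E₁ := (TangentSpace I : M → Type _))
    (E₂ := (TangentSpace I : M → Type _)) (b := fun y ↦ y)
    ((S.contMDiff_phi x).mdifferentiableAt (by simp)) hX

theorem mdiffAt_xi (x : M) : MDiffAt (T% S.xi) x := (S.contMDiff_xi x).mdiffAt_field

theorem mdiffAt_eta_apply {X : Π x : M, TangentSpace I x} {x : M}
    (hX : MDiffAt (T% X) x) : MDiffAt (fun y ↦ S.eta y (X y)) x := by
  simp only [S.eta_eq_inner]
  exact mdiff_inner (mdiffAt_xi x) hX

theorem contMDiffAt_eta_apply {X : Π x : M, TangentSpace I x} {x : M}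
    (hX : CMDiffAt ∞ (T% X) x) : CMDiffAt ∞ (fun y ↦ S.eta y (X y)) x := by
  simp only [S.eta_eq_inner]
  exact contMDiffAt_inner (S.contMDiff_xi x) hX

/-- `Y ↦ ∇(φY) - φ∇Y` involves no derivative of `Y`, so that `∇φ` is a tensor. -/
theorem tensorialAt_nablaPhi (S : AlmostContactMetricStructure I M) (x : M) :
    TensorialAt I E (fun Y ↦ leviCivita I M (fun y ↦ S.phi y (Y y)) x
      - (S.phi x) ∘L (leviCivita I M Y x)) x where
  smul {f Y} hf hY := by
    ext u
    have h1 := leviCivita_smul hf (mdiffAt_phi_apply (S := S) hY) u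
    have h2 := leviCivita_smul hf hY u
    have h3 : (fun y ↦ S.phi y ((f • Y) y)) = fun y ↦ f y • S.phi y (Y y) := by
      funext y
      simp
    rw [h3]
    change leviCivita I M (fun y ↦ f y • S.phi y (Y y)) x u
      - S.phi x (leviCivita I M (fun y ↦ f y • Y y) x u) = _
    rw [h1, h2]
    simp [smul_sub]
  add {Y Y'} hY hY' := by
    ext u
    have h1 := leviCivita_add (mdiffAt_phi_apply (S := S) hY) (mdiffAt_phi_apply (S := S) hY') u
    have h2 := leviCivita_add hY hY' u
    have h3 : (fun y ↦ S.phi y ((Y + Y') y)) = fun y ↦ S.phi y (Y y) + S.phi y (Y' y) := by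
      funext y
      simp
    rw [h3]
    change leviCivita I M (fun y ↦ S.phi y (Y y) + S.phi y (Y' y)) x u
      - S.phi x (leviCivita I M (fun y ↦ Y y + Y' y) x u) = _
    rw [h1, h2]
    simp
    abel

/-- The covariant derivative of `φ`: `nablaPhi S x v u` is `(∇_u φ) v`. -/
noncomputable def nablaPhi (S : AlmostContactMetricStructure I M) (x : M) :
    TangentSpace I x →L[ℝ] TangentSpace I x →L[ℝ] TangentSpace I x :=
  TensorialAt.mkHom _ x (tensorialAt_nablaPhi S x)

theorem nablaPhi_apply {Y : Π x : M, TangentSpace I x} {x : M} (hY : MDiffAt (T% Y) x)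
    (u : TangentSpace I x) :
    S.nablaPhi x (Y x) u
      = leviCivita I M (fun y ↦ S.phi y (Y y)) x u - S.phi x (leviCivita I M Y x u) := by
  rw [nablaPhi, TensorialAt.mkHom_apply _ hY]
  rfl

theorem leviCivita_phi {Y : Π x : M, TangentSpace I x} {x : M} (hY : MDiffAt (T% Y) x)
    (u : TangentSpace I x) :
    leviCivita I M (fun y ↦ S.phi y (Y y)) x u
      = S.nablaPhi x (Y x) u + S.phi x (leviCivita I M Y x u) := by
  rw [nablaPhi_apply hY]
  abel

theorem mvfderiv_eta {Y : Π x : M, TangentSpace I x} {x : M} (hY : MDiffAt (T% Y) x)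
    (u : TangentSpace I x) :
    mvfderiv I (fun y ↦ S.eta y (Y y)) x u
      = inner ℝ (leviCivita I M S.xi x u) (Y x) + S.eta x (leviCivita I M Y x u) := by
  have h := mvfderiv_inner_eq_leviCivita (FiberBundle.mdifferentiableAt_extend I E u)
    (mdiffAt_xi (S := S) x) hY
  rw [FiberBundle.extend_apply_self] at h
  simp only [S.eta_eq_inner]
  exact h

theorem inner_leviCivita_xi_xi (x : M) (u : TangentSpace I x) :
    inner ℝ (leviCivita I M S.xi x u) (S.xi x) = (0 : ℝ) := by
  have h := mvfderiv_eta (S := S) (mdiffAt_xi (S := S) x) u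
  have h1 : mvfderiv I (fun y ↦ S.eta y (S.xi y)) x = 0 := by
    simp only [S.eta_xi]
    exact mvfderiv_const ..
  rw [h1, S.eta_eq_inner, real_inner_comm _ (S.xi x)] at h
  simp at h
  linarith

/-- `∇_u φ` is skew-adjoint, as `φ` is. -/
theorem nablaPhi_skew (x : M) (u v w : TangentSpace I x) :
    inner ℝ (S.nablaPhi x v u) w = (-inner ℝ (S.nablaPhi x w u) v : ℝ) := by
  have hu := FiberBundle.mdifferentiableAt_extend I E u
  have hv := FiberBundle.mdifferentiableAt_extend I E v
  have hw := FiberBundle.mdifferentiableAt_extend I E w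
  have h1 := mvfderiv_inner_eq_leviCivita hu (mdiffAt_phi_apply (S := S) hv) hw
  have h2 := mvfderiv_inner_eq_leviCivita hu (mdiffAt_phi_apply (S := S) hw) hv
  have h3 : (fun y ↦ inner ℝ (S.phi y (FiberBundle.extend E v y)) (FiberBundle.extend E w y))
      = fun y ↦ -(inner ℝ (S.phi y (FiberBundle.extend E w y)) (FiberBundle.extend E v y) : ℝ) := by
    funext y
    rw [inner_phi_left, real_inner_comm]
  rw [h3, mvfderiv_fun_neg, neg_apply, h2, leviCivita_phi hv, leviCivita_phi hw] at h1
  simp only [FiberBundle.extend_apply_self, inner_add_left, inner_phi_left] at h1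
  rw [S.inner_phi_swap x w, S.inner_phi_swap x v] at h1
  linarith

/-- The derivative of `φ² = -1 + η ⊗ ξ`. -/
theorem nablaPhi_phi (x : M) (u v : TangentSpace I x) :
    S.nablaPhi x (S.phi x v) u + S.phi x (S.nablaPhi x v u)
      = (inner ℝ (leviCivita I M S.xi x u) v : ℝ) • S.xi x
        + S.eta x v • leviCivita I M S.xi x u := by
  have hv := FiberBundle.mdifferentiableAt_extend I E v
  have h1 := leviCivita_phi (S := S) (mdiffAt_phi_apply (S := S) hv) u
  rw [leviCivita_phi hv] at h1
  have h2 : (fun y ↦ S.phi y (S.phi y (FiberBundle.extend E v y)))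
      = fun y ↦ S.eta y (FiberBundle.extend E v y) • S.xi y - FiberBundle.extend E v y := by
    funext y
    rw [S.phi_phi]
    abel
  have h3 : MDiffAt (T% (fun y ↦ S.eta y (FiberBundle.extend E v y) • S.xi y)) x :=
    (mdiffAt_eta_apply hv).smul_section (mdiffAt_xi x)
  rw [h2, leviCivita_sub h3 hv,
    leviCivita_smul (mdiffAt_eta_apply hv) (mdiffAt_xi x), mvfderiv_eta hv] at h1
  simp only [FiberBundle.extend_apply_self, map_add, S.phi_phi] at h1
  rw [← sub_eq_zero] at h1 ⊢
  rw [← neg_eq_zero, ← h1]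
  module

/-- The derivative of `φ ξ = 0`. -/
theorem nablaPhi_xi (x : M) (u : TangentSpace I x) :
    S.nablaPhi x (S.xi x) u = -S.phi x (leviCivita I M S.xi x u) := by
  rw [nablaPhi_apply (mdiffAt_xi x)]
  have h : (fun y ↦ S.phi y (S.xi y)) = fun y ↦ (0 : ℝ) • S.xi y := by
    funext y
    rw [S.phi_xi, zero_smul]
  rw [h, leviCivita_smul mdifferentiableAt_const (mdiffAt_xi x)]
  have h0 : mvfderiv I (fun _ : M ↦ (0 : ℝ)) x = 0 := mvfderiv_const ..
  simp [h0]

/-- In the torsion-free connection, `2 dη` is the alternation of `∇ξ`. -/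
theorem dEta_eq {X Y : Π x : M, TangentSpace I x} {x : M} (hX : MDiffAt (T% X) x)
    (hY : MDiffAt (T% Y) x) :
    2 * S.dEta X Y x = inner ℝ (leviCivita I M S.xi x (X x)) (Y x)
      - inner ℝ (leviCivita I M S.xi x (Y x)) (X x) := by
  rw [dEta, mvfderiv_eta hX, mvfderiv_eta hY, ← leviCivita_sub_leviCivita hX hY, map_sub]
  ring

theorem IsContactMetric.leviCivita_xi_alternating (h : S.IsContactMetric) (x : M)
    (u v : TangentSpace I x) :
    inner ℝ (leviCivita I M S.xi x u) v - inner ℝ (leviCivita I M S.xi x v) u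
      = 2 * (inner ℝ u (S.phi x v) : ℝ) := by
  have hu := FiberBundle.mdifferentiableAt_extend I E u
  have hv := FiberBundle.mdifferentiableAt_extend I E v
  have h1 := h x _ _ hu hv
  have h2 := dEta_eq (S := S) hu hv
  rw [h1] at h2
  simpa using h2.symm

/-- Normality in terms of the covariant derivative of `φ`. -/
theorem IsSasakian.nablaPhi_normal (h : S.IsSasakian) (x : M) (u v : TangentSpace I x) :
    S.nablaPhi x v (S.phi x u) - S.nablaPhi x u (S.phi x v) + S.phi x (S.nablaPhi x u v)
      - S.phi x (S.nablaPhi x v u) + (2 * (inner ℝ u (S.phi x v) : ℝ)) • S.xi x = 0 := by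
  have hu := FiberBundle.mdifferentiableAt_extend I E u
  have hv := FiberBundle.mdifferentiableAt_extend I E v
  have hφu := mdiffAt_phi_apply (S := S) hu
  have hφv := mdiffAt_phi_apply (S := S) hv
  have h1 := h.2 x _ _ hu hv
  rw [h.1 x _ _ hu hv, nijenhuis, ← leviCivita_sub_leviCivita hu hv,
    ← leviCivita_sub_leviCivita hφu hφv, ← leviCivita_sub_leviCivita hφu hv,
    ← leviCivita_sub_leviCivita hu hφv, leviCivita_phi hu, leviCivita_phi hu, leviCivita_phi hv,
    leviCivita_phi hv] at h1
  simp only [FiberBundle.extend_apply_self, map_add, map_sub] at h1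
  rw [← h1]
  module

/-- The fundamental `2`-form of a contact metric structure is closed, being exact. -/
theorem IsContactMetric.nablaPhi_cyclic (h : S.IsContactMetric) (x : M)
    (u v w : TangentSpace I x) :
    inner ℝ (S.nablaPhi x w u) v + inner ℝ (S.nablaPhi x u v) w
      + inner ℝ (S.nablaPhi x v w) u = (0 : ℝ) := by
  -- The left-hand side is twice the derivative of `⟨V, φW⟩` along `U`, minus `2⟨[U, V], φW⟩`; the
  -- right-hand side is the same quantity with `⟨·, φ·⟩` replaced by `dη`. In the cyclic sum the
  -- second derivatives cancel, and the Jacobi identity removes the iterated brackets.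
  have key {U V W : Π x : M, TangentSpace I x} (hU : CMDiffAt ∞ (T% U) x)
      (hV : CMDiffAt ∞ (T% V) x) (hW : CMDiffAt ∞ (T% W) x) :
      2 * inner ℝ (V x) (S.nablaPhi x (W x) (U x))
        + 2 * inner ℝ (V x) (S.phi x (leviCivita I M W x (U x)))
        + 2 * inner ℝ (leviCivita I M U x (V x)) (S.phi x (W x))
      = mvfderiv I (fun y ↦ mvfderiv I (fun z ↦ S.eta z (W z)) y (V y)) x (U x)
        - mvfderiv I (fun y ↦ mvfderiv I (fun z ↦ S.eta z (V z)) y (W y)) x (U x)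
        - mvfderiv I (fun y ↦ S.eta y (VectorField.mlieBracket I V W y)) x (U x)
        - (mvfderiv I (fun y ↦ mvfderiv I (fun z ↦ S.eta z (W z)) y (V y)) x (U x)
          - mvfderiv I (fun y ↦ mvfderiv I (fun z ↦ S.eta z (W z)) y (U y)) x (V x))
        + mvfderiv I (fun y ↦ S.eta y (VectorField.mlieBracket I U V y)) x (W x)
        + S.eta x (VectorField.mlieBracket I (VectorField.mlieBracket I U V) W x) := by
    have hVW := contMDiffAt_mlieBracket hV hW
    have hUV := contMDiffAt_mlieBracket hU hV
    have hVW' := contMDiffAt_eta_apply (S := S) hVW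
    have hηV := contMDiffAt_eta_apply (S := S) hV
    have hηW := contMDiffAt_eta_apply (S := S) hW
    have h1 : (fun y ↦ (inner ℝ (V y) (S.phi y (W y)) : ℝ)) =ᶠ[nhds x]
        fun y ↦ 1 / 2 * (mvfderiv I (fun z ↦ S.eta z (W z)) y (V y)
          - mvfderiv I (fun z ↦ S.eta z (V z)) y (W y)
          - S.eta y (VectorField.mlieBracket I V W y)) := by
      filter_upwards [eventually_mdiffAt hV, eventually_mdiffAt hW] with y h1 h2
      exact (h y V W h1 h2).symm
    have m1 : MDiffAt (fun y ↦ mvfderiv I (fun z ↦ S.eta z (W z)) y (V y)) x :=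
      (contMDiffAt_mvfderiv_apply hηW hV).mdifferentiableAt (by simp)
    have m2 : MDiffAt (fun y ↦ mvfderiv I (fun z ↦ S.eta z (V z)) y (W y)) x :=
      (contMDiffAt_mvfderiv_apply hηV hW).mdifferentiableAt (by simp)
    have m3 : MDiffAt (fun y ↦ S.eta y (VectorField.mlieBracket I V W y)) x :=
      hVW'.mdifferentiableAt (by simp)
    have h2 := congrArg (· (U x)) (mvfderiv_congr_of_eventuallyEq (I := I) h1)
    rw [mvfderiv_inner_eq_leviCivita hU.mdiffAt_field hV.mdiffAt_field
      (mdiffAt_phi_apply hW.mdiffAt_field), leviCivita_phi hW.mdiffAt_field,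
      mvfderiv_const_mul_sub_sub _ m1 m2 m3] at h2
    have h3 := h x _ W hUV.mdiffAt_field hW.mdiffAt_field
    rw [dEta, mvfderiv_mlieBracket hηW hU hV,
      ← leviCivita_sub_leviCivita hU.mdiffAt_field hV.mdiffAt_field] at h3
    simp [inner_add_right, inner_sub_left] at h2 h3
    linarith
  have hu : CMDiffAt ∞ (T% (FiberBundle.extend E u)) x := FiberBundle.contMDiffAt_extend I E u
  have hv : CMDiffAt ∞ (T% (FiberBundle.extend E v)) x := FiberBundle.contMDiffAt_extend I E v
  have hw : CMDiffAt ∞ (T% (FiberBundle.extend E w)) x := FiberBundle.contMDiffAt_extend I E w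
  have hJ := congrArg (S.eta x) (mlieBracket_jacobi hu hv hw)
  have s1 := VectorField.mlieBracket_swap_apply (I := I) (x := x) (V := FiberBundle.extend E u)
    (W := VectorField.mlieBracket I (FiberBundle.extend E v) (FiberBundle.extend E w))
  have s2 := VectorField.mlieBracket_swap_apply (I := I) (x := x) (V := FiberBundle.extend E v)
    (W := VectorField.mlieBracket I (FiberBundle.extend E u) (FiberBundle.extend E w))
  have s3 : VectorField.mlieBracket I (FiberBundle.extend E u) (FiberBundle.extend E w)
      = (-1 : ℝ) • VectorField.mlieBracket I (FiberBundle.extend E w) (FiberBundle.extend E u) := by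
    rw [VectorField.mlieBracket_swap, neg_one_smul]
  rw [s1, s2, s3, VectorField.mlieBracket_const_smul_left
    (contMDiffAt_mlieBracket hw hu).mdiffAt_field] at hJ
  have k1 := key hu hv hw
  have k2 := key hv hw hu
  have k3 := key hw hu hv
  simp only [FiberBundle.extend_apply_self] at k1 k2 k3
  simp only [map_add, map_neg, neg_smul, one_smul, neg_neg] at hJ
  rw [S.inner_phi_swap x v] at k1
  rw [S.inner_phi_swap x w] at k2
  rw [S.inner_phi_swap x u] at k3
  rw [real_inner_comm v, real_inner_comm w, real_inner_comm u]
  linarith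

/-! ### Curvature of Sasakian manifolds -/

theorem IsSasakian.leviCivita_xi (h : S.IsSasakian) (x : M) (u : TangentSpace I x) :
    leviCivita I M S.xi x u = -S.phi x u :=
  nabla_xi_of_structure (S.phi_phi x) (S.eta_xi x) (S.phi_xi x) (S.eta_phi x) (S.inner_phi_phi x)
    (h.1.leviCivita_xi_alternating x) (inner_leviCivita_xi_xi x) (nablaPhi_skew x)
    (h.1.nablaPhi_cyclic x) (nablaPhi_xi x) (h.nablaPhi_normal x) u

theorem IsSasakian.nablaPhi_eq (h : S.IsSasakian) (x : M) (u v : TangentSpace I x) :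
    S.nablaPhi x v u = (inner ℝ u v : ℝ) • S.xi x - S.eta x v • u :=
  nabla_phi_of_structure (S.phi_phi x) (S.eta_xi x) (S.phi_xi x) (S.eta_phi x) (S.inner_phi_phi x)
    (h.leviCivita_xi x) (nablaPhi_skew x) (h.1.nablaPhi_cyclic x) (nablaPhi_phi x) (nablaPhi_xi x)
    (h.nablaPhi_normal x) u v

theorem IsSasakian.leviCivita_phi_eq (h : S.IsSasakian) {Y : Π x : M, TangentSpace I x} {x : M}
    (hY : MDiffAt (T% Y) x) (u : TangentSpace I x) :
    leviCivita I M (fun y ↦ S.phi y (Y y)) x u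
      = (inner ℝ u (Y x) : ℝ) • S.xi x - S.eta x (Y x) • u + S.phi x (leviCivita I M Y x u) := by
  rw [leviCivita_phi hY, h.nablaPhi_eq]

theorem IsSasakian.curvature_xi (h : S.IsSasakian) (x : M) (u v : TangentSpace I x) :
    curvature I x u v (S.xi x) = S.eta x v • u - S.eta x u • v := by
  have hu := FiberBundle.mdifferentiableAt_extend I E u
  have hv := FiberBundle.mdifferentiableAt_extend I E v
  rw [curvature_eq_curvatureField u v (S.contMDiff_xi x), curvatureField]
  simp only [h.leviCivita_xi]
  rw [leviCivita_neg (mdiffAt_phi_apply hv), leviCivita_neg (mdiffAt_phi_apply hu),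
    ← leviCivita_sub_leviCivita hu hv, h.leviCivita_phi_eq hu, h.leviCivita_phi_eq hv,
    FiberBundle.extend_apply_self, FiberBundle.extend_apply_self, map_sub, real_inner_comm]
  module

/-- The failure of the curvature operators to commute with `φ`, obtained by differentiating
`∇_Y(φZ) = φ∇_Y Z + ⟨Y, Z⟩ ξ - η(Z) Y` once more. -/
theorem IsSasakian.curvature_phi (h : S.IsSasakian) (x : M) (u v w : TangentSpace I x) :
    curvature I x u v (S.phi x w) - S.phi x (curvature I x u v w)
      = (inner ℝ u w : ℝ) • S.phi x v - (inner ℝ v w : ℝ) • S.phi x u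
        + (inner ℝ (S.phi x u) w : ℝ) • v - (inner ℝ (S.phi x v) w : ℝ) • u := by
  have key {X Y Z : Π x : M, TangentSpace I x} (hX : CMDiffAt ∞ (T% X) x)
      (hY : CMDiffAt ∞ (T% Y) x) (hZ : CMDiffAt ∞ (T% Z) x) :
      leviCivita I M (fun y ↦ leviCivita I M (fun z ↦ S.phi z (Z z)) y (Y y)) x (X x)
        = S.phi x (leviCivita I M (fun y ↦ leviCivita I M Z y (Y y)) x (X x))
          - (inner ℝ (Y x) (Z x) : ℝ) • S.phi x (X x)
          + (inner ℝ (leviCivita I M Y x (X x)) (Z x)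
            + inner ℝ (Y x) (leviCivita I M Z x (X x)) : ℝ) • S.xi x
          - S.eta x (Z x) • leviCivita I M Y x (X x)
          - (-inner ℝ (S.phi x (X x)) (Z x) + S.eta x (leviCivita I M Z x (X x)) : ℝ) • Y x
          + (inner ℝ (X x) (leviCivita I M Z x (Y x)) : ℝ) • S.xi x
          - S.eta x (leviCivita I M Z x (Y x)) • X x := by
    have hYZ := contMDiffAt_leviCivita hY hZ
    have h1 : ∀ᶠ y in nhds x, leviCivita I M (fun z ↦ S.phi z (Z z)) y (Y y)
        = (inner ℝ (Y y) (Z y) : ℝ) • S.xi y - S.eta y (Z y) • Y y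
          + S.phi y (leviCivita I M Z y (Y y)) := by
      filter_upwards [eventually_mdiffAt hZ] with y hy
      exact h.leviCivita_phi_eq hy _
    have m1 : MDiffAt (T% (fun y ↦ (inner ℝ (Y y) (Z y) : ℝ) • S.xi y)) x :=
      (mdiff_inner hY.mdiffAt_field hZ.mdiffAt_field).smul_section (mdiffAt_xi x)
    have m2 : MDiffAt (T% (fun y ↦ S.eta y (Z y) • Y y)) x :=
      (mdiffAt_eta_apply hZ.mdiffAt_field).smul_section hY.mdiffAt_field
    have m12 : MDiffAt
        (T% (fun y ↦ (inner ℝ (Y y) (Z y) : ℝ) • S.xi y - S.eta y (Z y) • Y y)) x :=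
      mdifferentiableAt_sub_section m1 m2
    have m3 := mdiffAt_phi_apply (S := S) hYZ.mdiffAt_field
    rw [leviCivita_congr (contMDiffAt_leviCivita hY (contMDiffAt_phi_apply hZ)).mdiffAt_field
      (mdifferentiableAt_add_section m12 m3) h1]
    refine (leviCivita_add m12 m3 _).trans ?_
    rw [leviCivita_sub m1 m2,
      leviCivita_smul (mdiff_inner hY.mdiffAt_field hZ.mdiffAt_field) (mdiffAt_xi x),
      leviCivita_smul (mdiffAt_eta_apply hZ.mdiffAt_field) hY.mdiffAt_field,
      h.leviCivita_phi_eq hYZ.mdiffAt_field, mvfderiv_eta hZ.mdiffAt_field,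
      mvfderiv_inner_eq_leviCivita hX.mdiffAt_field hY.mdiffAt_field hZ.mdiffAt_field,
      h.leviCivita_xi, inner_neg_left]
    module
  have hu : CMDiffAt ∞ (T% (FiberBundle.extend E u)) x := FiberBundle.contMDiffAt_extend I E u
  have hv : CMDiffAt ∞ (T% (FiberBundle.extend E v)) x := FiberBundle.contMDiffAt_extend I E v
  have hw : CMDiffAt ∞ (T% (FiberBundle.extend E w)) x := FiberBundle.contMDiffAt_extend I E w
  have h1 := curvature_eq_curvatureField u v (contMDiffAt_phi_apply (S := S) hw)
  have h2 := curvature_eq_curvatureField u v hw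
  simp only [FiberBundle.extend_apply_self] at h1 h2
  rw [h1, h2, curvatureField, curvatureField, key hu hv hw, key hv hu hw,
    h.leviCivita_phi_eq hw.mdiffAt_field,
    ← leviCivita_sub_leviCivita hu.mdiffAt_field hv.mdiffAt_field]
  simp only [FiberBundle.extend_apply_self, map_sub, inner_sub_left]
  module

/-- The trace of `R(u,v)ξ = η(v) u - η(u) v` over `u`. -/
theorem IsSasakian.ricci_xi (h : S.IsSasakian) (x : M) (v : TangentSpace I x) :
    ricci I x v (S.xi x) = (Module.finrank ℝ E - 1) * S.eta x v := by
  have h1 (i) : (inner ℝ (curvature I x (frame I x i) v (S.xi x)) (frame I x i) : ℝ)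
      = S.eta x v - inner ℝ (S.xi x) (frame I x i) * inner ℝ (frame I x i) v := by
    rw [h.curvature_xi, inner_sub_left, real_inner_smul_left, real_inner_smul_left,
      S.eta_eq_inner x (frame I x i), real_inner_comm _ v, real_inner_self_eq_norm_sq,
      (frame I x).orthonormal.1 i]
    ring
  have h2 : Module.finrank ℝ (TangentSpace I x) = Module.finrank ℝ E := rfl
  simp only [ricci, h1, Finset.sum_sub_distrib]
  rw [(frame I x).sum_inner_mul_inner, ← S.eta_eq_inner]
  simp [h2]
  ring

/-! ### Weyl-flat and conformally flat Sasakian manifolds -/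

variable {n : ℕ}

theorem inner_phi_self (x : M) (v : TangentSpace I x) : inner ℝ v (S.phi x v) = (0 : ℝ) := by
  linarith [S.inner_phi_swap x v v]

/-- A Weyl-flat Sasakian metric is `η`-Einstein: the Weyl tensor on `(u, ξ, ξ)` expresses `Ric(u,v)`
through the known `R(u,ξ)ξ` and `Ric(·,ξ)`. -/
theorem IsSasakian.ricci_of_isWeylFlat (h : S.IsSasakian) (hn : 1 ≤ n)
    (hdim : Module.finrank ℝ E = 2 * n + 1) (hW : IsWeylFlat I M n) (x : M)
    (u v : TangentSpace I x) :
    ricci I x u v = (scalarCurvature I x / (2 * n) - 1) * inner ℝ u v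
      + (2 * n + 1 - scalarCurvature I x / (2 * n)) * (S.eta x u * S.eta x v) := by
  have hn1 : (1 : ℝ) ≤ n := by exact_mod_cast hn
  have hn0 : (n : ℝ) ≠ 0 := by positivity
  have hn2 : 2 * (n : ℝ) - 1 ≠ 0 := by linarith
  have hξ (w : TangentSpace I x) : ricci I x w (S.xi x) = 2 * n * S.eta x w := by
    rw [h.ricci_xi, hdim]
    push_cast
    ring
  have hinner : inner ℝ u (S.xi x) = S.eta x u := by rw [S.eta_eq_inner, real_inner_comm]
  have h1 := SasakianGeometry.inner_curvature_of_isWeylFlat x hW u (S.xi x) (S.xi x) v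
  rw [h.curvature_xi, hξ, hξ, ricci_symm x (S.xi x) v, hξ, inner_sub_left, real_inner_smul_left,
    real_inner_smul_left, hinner] at h1
  simp only [← S.eta_eq_inner, S.eta_xi] at h1
  field_simp at h1 ⊢
  linear_combination -h1

/-- When the last two vectors are orthogonal to `ξ`, the curvature of a Weyl-flat Sasakian metric
is that of a space form. -/
theorem IsSasakian.inner_curvature_of_isWeylFlat (h : S.IsSasakian) (hn : 1 ≤ n)
    (hdim : Module.finrank ℝ E = 2 * n + 1) (hW : IsWeylFlat I M n) (x : M)
    (u v w z : TangentSpace I x) (hw : S.eta x w = 0) (hz : S.eta x z = 0) :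
    inner ℝ (curvature I x u v w) z =
      (scalarCurvature I x - 4 * n) / (2 * n * (2 * n - 1))
        * (inner ℝ v w * inner ℝ u z - inner ℝ u w * inner ℝ v z : ℝ) := by
  have hn1 : (1 : ℝ) ≤ n := by exact_mod_cast hn
  have hn0 : (n : ℝ) ≠ 0 := by positivity
  have hn2 : 2 * (n : ℝ) - 1 ≠ 0 := by linarith
  rw [SasakianGeometry.inner_curvature_of_isWeylFlat x hW]
  simp only [h.ricci_of_isWeylFlat hn hdim hW, hw, hz]
  field_simp
  ring

theorem IsSasakian.starRicci_of_isWeylFlat (h : S.IsSasakian) (hn : 1 ≤ n)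
    (hdim : Module.finrank ℝ E = 2 * n + 1) (hW : IsWeylFlat I M n) (x : M)
    (X Y : TangentSpace I x) :
    S.starRicci x X Y = (scalarCurvature I x - 4 * n) / (2 * n * (2 * n - 1))
      * S.phiMetric x X Y := by
  have h1 (i) : (inner ℝ (curvature I x X (frame I x i) (S.phi x (frame I x i))) (S.phi x Y) : ℝ)
      = (scalarCurvature I x - 4 * n) / (2 * n * (2 * n - 1))
        * (inner ℝ (S.phi x X) (frame I x i) * inner ℝ (frame I x i) (S.phi x Y)) := by
    rw [h.inner_curvature_of_isWeylFlat hn hdim hW x _ _ _ _ (S.eta_phi x _) (S.eta_phi x _),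
      inner_phi_self, S.inner_phi_left]
    ring
  rw [starRicci, Finset.sum_congr rfl fun i _ ↦ h1 i, ← Finset.mul_sum,
    (frame I x).sum_inner_mul_inner, phiMetric]

/-- In dimension at least five, the commutation rule of curvature and `φ` on a plane spanned by
`u` and a vector orthogonal to `u`, `φu` and `ξ` normalizes the curvature to `1`. -/
theorem IsSasakian.scalarCurvature_of_isWeylFlat (h : S.IsSasakian) (hn : 2 ≤ n)
    (hdim : Module.finrank ℝ E = 2 * n + 1) (hW : IsWeylFlat I M n) (x : M) :
    (scalarCurvature I x - 4 * n) / (2 * n * (2 * n - 1)) = (1 : ℝ) := by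
  have hd : Module.finrank ℝ (TangentSpace I x) = 2 * n + 1 := hdim
  obtain ⟨u, hu0, hu⟩ := exists_ne_zero_inner_eq_zero ![S.xi x] (by omega)
  obtain ⟨v, hv0, hv⟩ := exists_ne_zero_inner_eq_zero ![S.xi x, u, S.phi x u] (by omega)
  have hηu : S.eta x u = 0 := by simpa [S.eta_eq_inner] using hu 0
  have hηv : S.eta x v = 0 := by simpa [S.eta_eq_inner] using hv 0
  have huv : inner ℝ u v = (0 : ℝ) := by simpa using hv 1
  have hφuv : inner ℝ (S.phi x u) v = (0 : ℝ) := by simpa using hv 2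
  have hφvu : inner ℝ (S.phi x v) u = (0 : ℝ) := by
    rw [S.inner_phi_left, real_inner_comm, hφuv, neg_zero]
  have h1 := congrArg (inner ℝ · (S.phi x v)) (h.curvature_phi x u v u)
  have h2 := h.inner_curvature_of_isWeylFlat (by omega) hdim hW x u v (S.phi x u) (S.phi x v)
    (S.eta_phi x _) (S.eta_phi x _)
  have h3 := h.inner_curvature_of_isWeylFlat (by omega) hdim hW x u v u v hηu hηv
  simp only [inner_sub_left, inner_add_left, real_inner_smul_left, S.inner_phi_phi, h2, h3,
    inner_phi_self, real_inner_comm u v, huv, hφuv, hφvu, hηu, hηv,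
    S.inner_phi_left x u u, real_inner_comm (S.phi x u) v] at h1
  have hu2 : (inner ℝ u u : ℝ) ≠ 0 := inner_self_ne_zero.2 hu0
  have hv2 : (inner ℝ v v : ℝ) ≠ 0 := inner_self_ne_zero.2 hv0
  exact mul_right_cancel₀ (mul_ne_zero hu2 hv2) (by linear_combination h1)

/-- In dimension three, the component `(φu, u, ξ)` of the Cotton tensor is a nonzero multiple of
`r - 6`. -/
theorem IsSasakian.scalarCurvature_of_isCottonFlat (h : S.IsSasakian)
    (hdim : Module.finrank ℝ E = 2 * 1 + 1) (hW : IsWeylFlat I M 1) (hC : IsCottonFlat I M 1)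
    (x : M) : scalarCurvature I x = 6 := by
  have hd : Module.finrank ℝ (TangentSpace I x) = 2 * 1 + 1 := hdim
  obtain ⟨u, hu0, hu⟩ := exists_ne_zero_inner_eq_zero ![S.xi x] (by omega)
  have hηu : S.eta x u = 0 := by simpa [S.eta_eq_inner] using hu 0
  -- As the Schouten tensor `P` satisfies `P(W, ξ) = 0` for a field `W` orthogonal to
  -- `ξ`, only the two connection terms of `∇P` survive and no derivative of the
  -- scalar curvature enters.
  have key {V W : Π x : M, TangentSpace I x} (hV : CMDiffAt ∞ (T% V) x)
      (hW' : CMDiffAt ∞ (T% W) x) (hηW : ∀ y, S.eta y (W y) = 0) :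
      covDerivSchouten I 1 V W S.xi x
        = (scalarCurvature I x / 2 - 3) * inner ℝ (S.phi x (V x)) (W x) := by
    have h1 := mvfderiv_eta (S := S) hW'.mdiffAt_field (V x)
    simp only [hηW] at h1
    have h0 : mvfderiv I (fun _ : M ↦ (0 : ℝ)) x = 0 := mvfderiv_const ..
    rw [h0, h.leviCivita_xi, inner_neg_left] at h1
    have h2 : (fun y ↦ schouten I 1 y (W y) (S.xi y)) = fun _ ↦ 0 := by
      funext y
      rw [schouten, h.ricci_xi, hηW, real_inner_comm, ← S.eta_eq_inner, hηW]
      simp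
    have h3 : S.eta x (leviCivita I M W x (V x)) = inner ℝ (S.phi x (V x)) (W x) := by
      simp at h1
      linarith
    rw [covDerivSchouten, h2, h0, schouten, schouten, h.leviCivita_xi, h.ricci_xi, hdim,
      h.ricci_of_isWeylFlat le_rfl hdim hW, real_inner_comm (S.xi x), ← S.eta_eq_inner, h3,
      inner_neg_right, real_inner_comm (S.phi x (V x)), hηW]
    simp
    ring
  -- The fields `φU`, `φU'` with `U x = u` and `U' x = φ u` take the values `φ u`, `-u` at `x` and
  -- are orthogonal to `ξ` everywhere.
  have hX : CMDiffAt ∞ (T% (fun y ↦ S.phi y (FiberBundle.extend E u y))) x :=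
    contMDiffAt_phi_apply (FiberBundle.contMDiffAt_extend I E u)
  have hY : CMDiffAt ∞ (T% (fun y ↦ S.phi y (FiberBundle.extend E (S.phi x u) y))) x :=
    contMDiffAt_phi_apply (FiberBundle.contMDiffAt_extend I E (S.phi x u))
  have h1 := hC x _ _ _ hX hY (S.contMDiff_xi x)
  rw [key hX hY fun y ↦ S.eta_phi y _, key hY hX fun y ↦ S.eta_phi y _] at h1
  simp only [FiberBundle.extend_apply_self, S.phi_phi, hηu, zero_smul, add_zero, map_neg,
    inner_neg_left, inner_neg_right, S.inner_phi_phi] at h1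
  have hu2 : (inner ℝ u u : ℝ) ≠ 0 := inner_self_ne_zero.2 hu0
  have h2 : (scalarCurvature I x / 2 - 3) * (inner ℝ u u : ℝ) = 0 := by linear_combination h1 / 2
  rcases mul_eq_zero.1 h2 with h3 | h3
  · linarith
  · exact absurd h3 hu2

/-- A conformally flat Sasakian manifold is `φ`-Einstein, with constant `1`: the scalar curvature
equals `2n(2n+1)` at every point. -/
theorem IsSasakian.isPhiEinstein_of_isConformallyFlat (h : S.IsSasakian) (hn : 1 ≤ n)
    (hdim : Module.finrank ℝ E = 2 * n + 1) (hC : IsConformallyFlat I M n) :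
    S.IsPhiEinstein := by
  have hc (x : M) : (scalarCurvature I x - 4 * n) / (2 * n * (2 * n - 1)) = (1 : ℝ) := by
    rcases hn.eq_or_lt with rfl | hn2
    · rw [h.scalarCurvature_of_isCottonFlat hdim hC.1 (hC.2 rfl)]
      norm_num
    · exact h.scalarCurvature_of_isWeylFlat hn2 hdim hC.1 x
  refine ⟨1, fun x X Y ↦ ?_⟩
  have hsymm : S.phiMetric x Y X = S.phiMetric x X Y := real_inner_comm _ _
  rw [phiRicci, h.starRicci_of_isWeylFlat hn hdim hC.1, h.starRicci_of_isWeylFlat hn hdim hC.1,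
    hc, hsymm]
  ring

end AlmostContactMetricStructure

end SasakianGeometry

theorem mainTheorem6 (n : ℕ) (hn : 1 ≤ n)
    {M : Type*} [TopologicalSpace M] [T2Space M] [SecondCountableTopology M] [ConnectedSpace M]
    [ChartedSpace (EuclideanSpace ℝ (Fin (2 * n + 1))) M] [IsManifold (𝓡 (2 * n + 1)) ∞ M]
    [RiemannianBundle (fun x : M ↦ TangentSpace (𝓡 (2 * n + 1)) x)]
    [IsContMDiffRiemannianBundle (𝓡 (2 * n + 1)) ∞ (EuclideanSpace ℝ (Fin (2 * n + 1)))
      (fun x : M ↦ TangentSpace (𝓡 (2 * n + 1)) x)]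
    (S : SasakianGeometry.AlmostContactMetricStructure (𝓡 (2 * n + 1)) M)
    (hS : S.IsSasakian) :
    (SasakianGeometry.IsWeylFlat (𝓡 (2 * n + 1)) M n →
      ∀ (x : M) (X Y : TangentSpace (𝓡 (2 * n + 1)) x),
        S.starRicci x X Y =
          (SasakianGeometry.scalarCurvature (𝓡 (2 * n + 1)) x - 4 * (n : ℝ))
            / (2 * (n : ℝ) * (2 * (n : ℝ) - 1)) * S.phiMetric x X Y) ∧
    (SasakianGeometry.IsConformallyFlat (𝓡 (2 * n + 1)) M n → S.IsPhiEinstein) := by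
  have hdim : Module.finrank ℝ (EuclideanSpace ℝ (Fin (2 * n + 1))) = 2 * n + 1 := by simp
  exact ⟨fun hW x X Y ↦ hS.starRicci_of_isWeylFlat hn hdim hW x X Y,
    fun hC ↦ hS.isPhiEinstein_of_isConformallyFlat hn hdim hC⟩
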